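/- Let $G$ and $H$ be finite groups and let $m>1$ be an integer. For a finite group $G$ with identity $e$, an element $x\in G\setminus\{e\}$ and integers $1\le k<l\le m+1$, let $\mathbf{x}_{[k,l)}\in G^m$ be the element whose $j$-th coordinate is $x$ for $k\le j<l$ and $e$ otherwise, and let $$\mathcal{S}(m)=\{\mathbf{x}_{[k,l)} : x\in G\setminus\{e\},\ 1\le k<l\le m+1\}\subseteq G^m .$$ Let $\mathscr{G}_m(G)=\mathrm{Cay}(G^m,\mathcal{S}(m))$ be the graph with vertex set $G^m$ in which $\mathbf{g}$ and $\mathbf{h}$ are adjacent if and only if $\mathbf{h}=\mathbf{s}\cdot\mathbf{g}$ for some $\mathbf{s}\in\mathcal{S}(m)$. Then the graphs $\mathscr{G}_m(G)$ and $\mathscr{G}_m(H)$ are isomorphic if and only if the groups $G$ and $H$ are isomorphic. -/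

import Mathlib

/-- The Cayley graph `Cay(Γ, S)` of a group `Γ` with respect to a symmetric set `S ⊆ Γ ∖ {1}`:
`g` and `h` are adjacent iff `h = s * g` for some `s ∈ S` (left multiplication). -/
def cayGraph {Γ : Type*} [Group Γ] (S : Set Γ) (hone : (1 : Γ) ∉ S)
    (hsymm : ∀ s ∈ S, s⁻¹ ∈ S) : SimpleGraph Γ where
  Adj g h := ∃ s ∈ S, h = s * g
  symm := ⟨by
    rintro g h ⟨s, hs, rfl⟩
    exact ⟨s⁻¹, hsymm s hs, by simp⟩⟩
  loopless := ⟨by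
    rintro g ⟨s, hs, h⟩
    have h1 : s = 1 := by simpa using h.symm
    exact hone (h1 ▸ hs)⟩

/-- The element `x_[k,l)` of `G ^ m` whose `j`-th coordinate (`1 ≤ j ≤ m`) is `x` if `k ≤ j < l` and
the identity otherwise. The index `i : Fin m` stands for the coordinate `j = i + 1`. -/
def intervalElem {G : Type*} [Group G] (m : ℕ) (x : G) (k l : ℕ) : Fin m → G :=
  fun i => if k ≤ (i : ℕ) + 1 ∧ (i : ℕ) + 1 < l then x else 1

/-- The union of all intervals: all `x_[k,l)` with `x ≠ 1` and `1 ≤ k < l ≤ m + 1`. -/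
def intervalSet (G : Type*) [Group G] (m : ℕ) : Set (Fin m → G) :=
  {s | ∃ (x : G) (k l : ℕ), x ≠ 1 ∧ 1 ≤ k ∧ k < l ∧ l ≤ m + 1 ∧ s = intervalElem m x k l}

theorem one_notMem_intervalSet (G : Type*) [Group G] (m : ℕ) :
    (1 : Fin m → G) ∉ intervalSet G m := by
  rintro ⟨x, k, l, hx, hk, hkl, hl, h⟩
  have h1 := congrFun h ⟨k - 1, by omega⟩
  have h2 : k ≤ k - 1 + 1 ∧ k - 1 + 1 < l := by omega
  simp only [intervalElem, Pi.one_apply, if_pos h2] at h1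
  exact hx h1.symm

theorem inv_mem_intervalSet (G : Type*) [Group G] (m : ℕ) :
    ∀ s ∈ intervalSet G m, s⁻¹ ∈ intervalSet G m := by
  rintro s ⟨x, k, l, hx, hk, hkl, hl, rfl⟩
  refine ⟨x⁻¹, k, l, inv_ne_one.mpr hx, hk, hkl, hl, ?_⟩
  funext i
  simp only [intervalElem, Pi.inv_apply]
  split_ifs <;> simp

/-- The graph `𝒢_m(G) = Cay(G ^ m, S(m))`. -/
def intervalCayGraph (m : ℕ) (G : Type*) [Group G] : SimpleGraph (Fin m → G) :=
  cayGraph (intervalSet G m) (one_notMem_intervalSet G m) (inv_mem_intervalSet G m)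

/-! Partial products identify a tuple in `G ^ m` with a word of length `m + 1` over `G` with product
`1`. Left multiplication by an interval element then changes exactly two letters, so the graph
becomes the graph of these words in which edges join words differing at two positions
(`codeGraphIso`). The words form a Latin code: all letters but one determine the last.

Two kinds of cliques contain a given codeword: lines, where two letters vary (size `|G|`), and stars
(size `m + 1`). A maximal clique with at least five vertices is one of these
(`IsLatin.eq_codeLine_or_codeStar`). For `|G| ≥ 5` an isomorphism maps no line to a star. Indeed,
two lines through `u` with disjoint pairs of positions neither meet nor are joined by an edge away
from `u`, whereas a star through `u` never stands in this relation to a line or star through `u`. So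
lines map to lines (`exists_image_codeLine`).

Normalize the isomorphism to fix `1`. If some `x` has `x * x ≠ 1`, the three lines through `1` on
three positions map to three lines of the same shape (`exists_coplanar`), and in this plane each
relevant letter of the image depends on one letter of the word (`image_plane`). The resulting maps
turn `x * y * z = 1` into the same kind of relation in `H`, possibly in reverse order, which makes
one of them a homomorphism or an antihomomorphism (`map_mul_of_triple`). The assumption `m > 1`
supplies the three positions.

In the remaining cases the order of the group suffices. Groups in which all squares are trivial are
recognized by the invariant `HasScatteredTriple` and are vector spaces over the field with two
elements. Other groups of order at most four are cyclic. -/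

/-! ### Latin codes: lines, stars and maximal cliques -/

section LatinCode

theorem exists_notMem_of_card_lt {τ : Type*} (s : Finset τ) (h : s.card < Nat.card τ) :
    ∃ k, k ∉ s := by
  by_contra! hcon
  have : (s : Set τ) = Set.univ := Set.eq_univ_of_forall hcon
  rw [← Set.ncard_coe_finset, this, Set.ncard_univ] at h
  exact lt_irrefl _ h

variable {ι G : Type*}

/-- A set of words is Latin if every word can be completed at every position in a unique way. -/
def IsLatin [DecidableEq ι] (C : Set (ι → G)) : Prop :=
  ∀ (w : ι → G) (i : ι), ∃! x, Function.update w i x ∈ C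

/-- The words `u` and `v` agree at all positions other than `i` and `j`. -/
def AgreeOff (u v : ι → G) (i j : ι) : Prop :=
  ∀ k, k ≠ i → k ≠ j → u k = v k

/-- The graph on a set of words in which two words are adjacent iff they differ at exactly two
positions. -/
def codeGraph (C : Set (ι → G)) : SimpleGraph C where
  Adj u v := ∃ i j, i ≠ j ∧ u.1 i ≠ v.1 i ∧ u.1 j ≠ v.1 j ∧ AgreeOff u.1 v.1 i j
  symm := ⟨by
    rintro u v ⟨i, j, hij, hi, hj, h⟩
    exact ⟨i, j, hij, hi.symm, hj.symm, fun k hk hk' => (h k hk hk').symm⟩⟩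
  loopless := ⟨by
    rintro u ⟨i, j, hij, hi, hj, h⟩
    exact hi rfl⟩

/-- The codewords that agree with `u` at all positions other than `i` and `j`. -/
def codeLine {C : Set (ι → G)} (u : C) (i j : ι) : Set C := {v | AgreeOff v.1 u.1 i j}

/-- The codewords that differ in one position from the word obtained from `u` by writing `x` at
position `i`. -/
def codeStar {C : Set (ι → G)} (u : C) (i : ι) (x : G) : Set C :=
  {v | v = u ∨ (v.1 i = x ∧ ∃ l, l ≠ i ∧ AgreeOff v.1 u.1 i l)}

/-- A clique that contains every vertex adjacent to all of its other vertices. -/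
def IsMaxClique {V : Type*} (Γ : SimpleGraph V) (K : Set V) : Prop :=
  (∀ u ∈ K, ∀ v ∈ K, u ≠ v → Γ.Adj u v) ∧ ∀ p, (∀ v ∈ K, p ≠ v → Γ.Adj p v) → p ∈ K

theorem IsMaxClique.image {V W : Type*} {Γ : SimpleGraph V} {Δ : SimpleGraph W} {K : Set V}
    (hK : IsMaxClique Γ K) (φ : Γ ≃g Δ) : IsMaxClique Δ (φ '' K) := by
  constructor
  · rintro _ ⟨u, hu, rfl⟩ _ ⟨v, hv, rfl⟩ h
    exact φ.map_adj_iff.2 (hK.1 u hu v hv (fun e => h (e ▸ rfl)))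
  · intro p hp
    refine ⟨φ.symm p, hK.2 _ fun v hv hne => ?_, by simp⟩
    have := hp (φ v) ⟨v, hv, rfl⟩ (fun e => hne (by simp [e]))
    rw [← φ.map_adj_iff]
    simpa using this

theorem agreeOff_iff {u v : ι → G} {i j : ι} :
    AgreeOff u v i j ↔ ∀ k, k = i ∨ k = j ∨ u k = v k := by
  simp only [AgreeOff, or_iff_not_imp_left, ne_eq]

theorem AgreeOff.swap {u v : ι → G} {i j : ι} (h : AgreeOff u v i j) : AgreeOff u v j i :=
  fun k hk hk' => h k hk' hk

theorem codeLine_comm {C : Set (ι → G)} (u : C) (i j : ι) : codeLine u i j = codeLine u j i :=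
  Set.ext fun _ => ⟨AgreeOff.swap, AgreeOff.swap⟩

theorem mem_codeLine_self {C : Set (ι → G)} (u : C) (i j : ι) : u ∈ codeLine u i j :=
  fun _ _ _ => rfl

variable {C : Set (ι → G)}

/-- Two codewords adjacent to each other and to `u` either lie on a common line through `u` or
share the new value at exactly one position. -/
theorem codeGraph_triangle {u v w : C} {i j : ι} (hij : i ≠ j)
    (hi : v.1 i ≠ u.1 i) (hj : v.1 j ≠ u.1 j) (hv : AgreeOff v.1 u.1 i j)
    (huw : (codeGraph C).Adj u w) (hvw : (codeGraph C).Adj v w) :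
    AgreeOff w.1 u.1 i j ∨
    (∃ l, l ≠ i ∧ l ≠ j ∧ w.1 i = v.1 i ∧ w.1 l ≠ u.1 l ∧ AgreeOff w.1 u.1 i l) ∨
    (∃ l, l ≠ i ∧ l ≠ j ∧ w.1 j = v.1 j ∧ w.1 l ≠ u.1 l ∧ AgreeOff w.1 u.1 j l) := by
  obtain ⟨a, b, hab, ha, hb, h⟩ := huw
  obtain ⟨c, d, hcd, hc, hd, h'⟩ := hvw
  simp only [agreeOff_iff] at *
  by_cases h1 : w.1 i = u.1 i <;> by_cases h2 : w.1 j = u.1 j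
  -- Otherwise `w` would differ from `v` at four positions: `i`, `j` and the two where it differs
  -- from `u`.
  · grind
  · right; right
    have : j = a ∨ j = b := by grind
    rcases this with rfl | rfl
    · refine ⟨b, ?_, ?_, ?_, ?_, ?_⟩ <;> grind
    · refine ⟨a, ?_, ?_, ?_, ?_, ?_⟩ <;> grind
  · right; left
    have : i = a ∨ i = b := by grind
    rcases this with rfl | rfl
    · refine ⟨b, ?_, ?_, ?_, ?_, ?_⟩ <;> grind
    · refine ⟨a, ?_, ?_, ?_, ?_, ?_⟩ <;> grind
  · left; grind

variable [DecidableEq ι]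

theorem IsLatin.eq_of_agree (hC : IsLatin C) {u v : C} (i : ι)
    (h : ∀ k, k ≠ i → u.1 k = v.1 k) : u = v := by
  have hv : Function.update u.1 i (v.1 i) = v.1 := by
    funext k
    by_cases hk : k = i
    · subst hk; simp
    · simp [hk, h k hk]
  have := (hC u.1 i).unique (y₁ := u.1 i) (y₂ := v.1 i) (by simp) (by rw [hv]; exact v.2)
  apply Subtype.ext
  rw [← hv, ← this]; simp

theorem IsLatin.eq_of_agreeOff (hC : IsLatin C) {u v : C} {i j : ι}
    (h : AgreeOff u.1 v.1 i j) (hi : u.1 i = v.1 i) : u = v :=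
  hC.eq_of_agree j fun k hk => by
    by_cases hki : k = i
    · rw [hki, hi]
    · exact h k hki hk

theorem IsLatin.adj_of_agreeOff (hC : IsLatin C) {u v : C} {i j : ι} (hij : i ≠ j)
    (h : AgreeOff u.1 v.1 i j) (hne : u ≠ v) : (codeGraph C).Adj u v :=
  ⟨i, j, hij, fun e => hne (hC.eq_of_agreeOff h e),
    fun e => hne (hC.eq_of_agreeOff h.swap e), h⟩

theorem IsLatin.exists_agreeOff (hC : IsLatin C) (u : C) {i j : ι} (hij : i ≠ j) (x : G) :
    ∃ v : C, v.1 i = x ∧ AgreeOff v.1 u.1 i j := by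
  obtain ⟨y, hy, -⟩ := hC (Function.update u.1 i x) j
  refine ⟨⟨_, hy⟩, by simp [hij], fun k hk hk' => by simp [hk, hk']⟩

theorem IsLatin.bijective_codeLine (hC : IsLatin C) (u : C) {i j : ι} (hij : i ≠ j) :
    Function.Bijective (fun v : codeLine u i j => v.1.1 i) := by
  constructor
  · rintro ⟨v, hv⟩ ⟨w, hw⟩ h
    exact Subtype.ext (hC.eq_of_agreeOff
      (fun k hk hk' => (hv k hk hk').trans (hw k hk hk').symm) h)
  · intro x
    obtain ⟨v, hv, h⟩ := hC.exists_agreeOff u hij x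
    exact ⟨⟨v, h⟩, hv⟩

theorem IsLatin.ncard_codeLine (hC : IsLatin C) (u : C) {i j : ι} (hij : i ≠ j) :
    (codeLine u i j).ncard = Nat.card G :=
  Nat.card_congr (Equiv.ofBijective _ (hC.bijective_codeLine u hij))

/-- Each position `l ≠ i` contributes the unique codeword with `x` at `i` that is corrected at `l`;
the slot `l = i` is taken by `u`. -/
theorem IsLatin.ncard_codeStar (hC : IsLatin C) (u : C) {i : ι} {x : G} (hx : x ≠ u.1 i) :
    (codeStar u i x).ncard = Nat.card ι := by
  have key : ∀ l : ι, ∃ v : C, v ∈ codeStar u i x ∧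
      (l = i → v = u) ∧ (l ≠ i → v.1 i = x ∧ AgreeOff v.1 u.1 i l) := by
    intro l
    by_cases hl : l = i
    · exact ⟨u, Or.inl rfl, fun _ => rfl, fun h => absurd hl h⟩
    · obtain ⟨v, hv, h⟩ := hC.exists_agreeOff u (Ne.symm hl) x
      exact ⟨v, Or.inr ⟨hv, l, hl, h⟩, fun h => absurd h hl, fun _ => ⟨hv, h⟩⟩
  choose f hf hfi hfl using key
  refine (Nat.card_congr (Equiv.ofBijective (fun l => (⟨f l, hf l⟩ : codeStar u i x)) ⟨?_, ?_⟩)).symm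
  · intro l l' h
    have h' : f l = f l' := congrArg Subtype.val h
    by_contra hne
    by_cases hl : l = i
    · have hl' : l' ≠ i := fun e => hne (hl.trans e.symm)
      apply hx
      rw [← (hfl l' hl').1, ← h', hfi l hl]
    · by_cases hl' : l' = i
      · apply hx
        rw [← (hfl l hl).1, h', hfi l' hl']
      · have : f l = u := hC.eq_of_agree i fun k hk => by
          by_cases hkl : k = l
          · rw [h']
            exact (hfl l' hl').2 k hk (fun e => hne (hkl.symm.trans e))
          · exact (hfl l hl).2 k hk hkl
        apply hx
        rw [← (hfl l hl).1, this]
  · rintro ⟨v, rfl | ⟨hv, l, hl, h⟩⟩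
    · exact ⟨i, Subtype.ext (hfi i rfl)⟩
    · refine ⟨l, Subtype.ext (hC.eq_of_agreeOff (i := i) (j := l) (fun k hk hk' => ?_) ?_)⟩
      · exact ((hfl l hl).2 k hk hk').trans (h k hk hk').symm
      · exact (hfl l hl).1.trans hv.symm

/-- A vertex `p` off the line already differs from its points at a third position, so being adjacent
to a point forces agreement with it at `i` or `j`. Each of these letters determines the point on the
line, so at most two points qualify, and the line has three. -/
theorem IsLatin.isMaxClique_codeLine (hC : IsLatin C) (hG : 3 ≤ Nat.card G) (u : C) {i j : ι}
    (hij : i ≠ j) : IsMaxClique (codeGraph C) (codeLine u i j) := by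
  constructor
  · intro v hv w hw hne
    exact hC.adj_of_agreeOff hij (fun k hk hk' => (hv k hk hk').trans (hw k hk hk').symm) hne
  · intro p hp
    by_contra hpl
    have hne : ∀ v ∈ codeLine u i j, p ≠ v := fun v hv e => hpl (e ▸ hv)
    have hag : ∀ v ∈ codeLine u i j, v.1 i = p.1 i ∨ v.1 j = p.1 j := by
      intro v hv
      obtain ⟨a, b, hab, ha, hb, h⟩ := hp v hv (hne v hv)
      have : ∃ k, k ≠ i ∧ k ≠ j ∧ p.1 k ≠ v.1 k := by
        by_contra! hcon
        exact hpl fun k hk hk' => (hcon k hk hk').trans (hv k hk hk')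
      rw [agreeOff_iff] at h
      grind
    have h2 : 2 < (codeLine u i j).ncard := by rw [hC.ncard_codeLine u hij]; omega
    obtain ⟨a, b, c, ha, hb, hc, hab, hac, hbc⟩ := (Set.two_lt_ncard_iff (Set.finite_of_ncard_pos
      (by omega))).1 h2
    have inj : ∀ v ∈ codeLine u i j, ∀ w ∈ codeLine u i j,
        (v.1 i = w.1 i ∨ v.1 j = w.1 j) → v = w := by
      intro v hv w hw h
      have hvw : AgreeOff v.1 w.1 i j := fun k hk hk' => (hv k hk hk').trans (hw k hk hk').symm
      exact h.elim (hC.eq_of_agreeOff hvw) (hC.eq_of_agreeOff hvw.swap)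
    have h1 := hag a ha
    have h2 := hag b hb
    have h3 := hag c hc
    have i1 := inj a ha b hb
    have i2 := inj a ha c hc
    have i3 := inj b hb c hc
    grind

/-- Three vertices in star position leave only one possible vertex outside the star, which completes
a tetrahedron. Such a 4-clique can occur, for instance in groups of exponent two; this is why five
vertices are required. -/
theorem IsLatin.eq_codeStar (hC : IsLatin C) {K : Set C} (hK : IsMaxClique (codeGraph C) K)
    (h5 : 5 ≤ K.ncard) {u v w : C} (hu : u ∈ K) (hv : v ∈ K) (hw : w ∈ K) {i j l : ι}
    (hij : i ≠ j) (hil : i ≠ l) (hjl : j ≠ l) (hvi : v.1 i ≠ u.1 i) (hvj : v.1 j ≠ u.1 j)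
    (hwl : w.1 l ≠ u.1 l) (hwi : w.1 i = v.1 i) (hvu : AgreeOff v.1 u.1 i j)
    (hwu : AgreeOff w.1 u.1 i l) : K = codeStar u i (v.1 i) := by
  have dich : ∀ z ∈ K, z ≠ u → (z.1 i = v.1 i ∧ ∃ k, k ≠ i ∧ AgreeOff z.1 u.1 i k) ∨
      (z.1 j = v.1 j ∧ z.1 l = w.1 l ∧ AgreeOff z.1 u.1 j l) := by
    intro z hz hzu
    by_cases hzv : z = v
    · subst hzv; exact Or.inl ⟨rfl, j, hij.symm, hvu⟩
    by_cases hzw : z = w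
    · subst hzw; exact Or.inl ⟨hwi, l, hil.symm, hwu⟩
    have auz := hK.1 u hu z hz (Ne.symm hzu)
    have t1 := codeGraph_triangle hij hvi hvj hvu auz (hK.1 v hv z hz (Ne.symm hzv))
    have t2 := codeGraph_triangle hil (hwi ▸ hvi) hwl hwu auz (hK.1 w hw z hz (Ne.symm hzw))
    rcases t1 with h | ⟨k, hki, hkj, e, hk, h⟩ | ⟨k, hki, hkj, e, hk, h⟩
    · rcases t2 with h' | ⟨k, hki, hkl, e, hk, h'⟩ | ⟨k, hki, hkl, e, hk, h'⟩
      · exact absurd (hC.eq_of_agree i fun k hk => by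
          by_cases hkj : k = j
          · exact h' k hk (hkj ▸ hjl)
          · exact h k hk hkj) hzu
      · exact Or.inl ⟨e.trans hwi, j, hij.symm, h⟩
      · exact absurd (e.symm.trans (h l hil.symm hjl.symm)) hwl
    · exact Or.inl ⟨e, k, hki, h⟩
    · right
      rcases t2 with h' | ⟨k', hki', hkl', e', hk', h'⟩ | ⟨k', hki', hkl', e', hk', h'⟩
      · exact absurd (e.symm.trans (h' j hij.symm hjl)) hvj
      · exact absurd ((hwi.symm.trans e'.symm).trans (h i hij hki.symm)) hvi
      · have : k = l := by
          by_contra hkl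
          exact hwl (e'.symm.trans (h l hjl.symm (Ne.symm hkl)))
        exact ⟨e, e', this ▸ h⟩
  have good : ∀ z ∈ K, z ≠ u → z.1 i = v.1 i ∧ ∃ k, k ≠ i ∧ AgreeOff z.1 u.1 i k := by
    intro z hz hzu
    refine (dich z hz hzu).resolve_right ?_
    rintro ⟨ej, el, h⟩
    -- A fifth vertex `z'` must change `i` and a new position `k`, while `z` changes `j` and `l`; so
    -- `z` and `z'` differ at four positions.
    obtain ⟨z', hz', hne⟩ : ∃ z' ∈ K, z' ∉ ({u, v, w, z} : Set C) := by
      by_contra! hcon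
      have h1 := Set.ncard_le_ncard (s := K) (t := {u, v, w, z}) hcon (Set.toFinite _)
      have h2 : ({u, v, w, z} : Set C).ncard ≤ 4 := by
        refine (Set.ncard_insert_le _ _).trans (Nat.succ_le_succ ?_)
        refine (Set.ncard_insert_le _ _).trans (Nat.succ_le_succ ?_)
        exact (Set.ncard_insert_le _ _).trans (by rw [Set.ncard_singleton])
      omega
    simp only [Set.mem_insert_iff, Set.mem_singleton_iff, not_or] at hne
    obtain ⟨n1, n2, n3, n4⟩ := hne
    rcases dich z' hz' n1 with ⟨ei', k, hki, h'⟩ | ⟨ej', el', h'⟩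
    · by_cases hkj : k = j
      · subst hkj
        exact n2 (hC.eq_of_agreeOff (fun t ht ht' => (h' t ht ht').trans (hvu t ht ht').symm) ei')
      by_cases hkl : k = l
      · subst hkl
        exact n3 (hC.eq_of_agreeOff (fun t ht ht' => (h' t ht ht').trans (hwu t ht ht').symm)
          (ei'.trans hwi.symm))
      obtain ⟨a, b, hab, ha, hb, hz⟩ := hK.1 z' hz' z hz n4
      simp only [agreeOff_iff] at *
      have := h i
      have := h' j
      have := h' l
      have := hz i
      have := hz j
      have := hz l
      grind
    · exact n4 (hC.eq_of_agreeOff (fun t ht ht' => (h' t ht ht').trans (h t ht ht').symm)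
          (ej'.trans ej.symm))
  apply Set.Subset.antisymm
  · intro z hz
    by_cases hzu : z = u
    · exact Or.inl hzu
    · exact Or.inr (good z hz hzu)
  · rintro p (rfl | ⟨hpi, k, hki, hp⟩)
    · exact hu
    · refine hK.2 p fun z hz hpz => ?_
      by_cases hzu : z = u
      · subst hzu
        exact hC.adj_of_agreeOff hki.symm hp hpz
      · obtain ⟨hzi, k', hki', hz'⟩ := good z hz hzu
        by_cases hkk : k = k'
        · subst hkk
          exact hC.adj_of_agreeOff hki.symm
            (fun t ht ht' => (hp t ht ht').trans (hz' t ht ht').symm) hpz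
        · refine hC.adj_of_agreeOff hkk (fun t ht ht' => ?_) hpz
          by_cases hti : t = i
          · rw [hti, hpi, hzi]
          · exact (hp t hti ht).trans (hz' t hti ht').symm

theorem IsLatin.eq_codeLine_or_codeStar (hC : IsLatin C) {K : Set C}
    (hK : IsMaxClique (codeGraph C) K) (h5 : 5 ≤ K.ncard) {u : C} (hu : u ∈ K) :
    (∃ i j, i ≠ j ∧ K = codeLine u i j) ∨ ∃ i x, x ≠ u.1 i ∧ K = codeStar u i x := by
  obtain ⟨v, hv, hvu⟩ := Set.exists_ne_of_one_lt_ncard (by omega : 1 < K.ncard) u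
  obtain ⟨i, j, hij, hi, hj, h⟩ := hK.1 v hv u hu hvu
  by_cases hall : ∀ w ∈ K, AgreeOff w.1 u.1 i j
  · refine Or.inl ⟨i, j, hij, Set.Subset.antisymm hall fun p hp => hK.2 p fun z hz hpz => ?_⟩
    exact hC.adj_of_agreeOff hij
      (fun t ht ht' => (hp t ht ht').trans (hall z hz t ht ht').symm) hpz
  · push Not at hall
    obtain ⟨w, hw, hwn⟩ := hall
    have hwu : u ≠ w := fun e => hwn (e ▸ fun _ _ _ => rfl)
    have hwv : v ≠ w := fun e => hwn (e ▸ h)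
    right
    rcases codeGraph_triangle hij hi hj h (hK.1 u hu w hw hwu) (hK.1 v hv w hw hwv) with
      hwl | ⟨l, hli, hlj, e, hl, hwl⟩ | ⟨l, hli, hlj, e, hl, hwl⟩
    · exact absurd hwl hwn
    · exact ⟨i, _, hi, hC.eq_codeStar hK h5 hu hv hw hij hli.symm hlj.symm hi hj hl e h hwl⟩
    · exact ⟨j, _, hj,
        hC.eq_codeStar hK h5 hu hv hw hij.symm hlj.symm hli.symm hj hi hl e h.swap hwl⟩

/-- A star through `u` and a line or star through `u` meet outside `u` or are joined by an edge
outside `u`. -/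
theorem IsLatin.exists_adj_codeStar (hC : IsLatin C) (hι : ∀ i j : ι, ∃ k, k ≠ i ∧ k ≠ j)
    {u : C} {i : ι} {x : G} (hx : x ≠ u.1 i) {L : Set C}
    (hL : (∃ k l, k ≠ l ∧ L = codeLine u k l) ∨ ∃ k y, y ≠ u.1 k ∧ L = codeStar u k y) :
    ∃ v ∈ codeStar u i x, ∃ w ∈ L, v ≠ u ∧ w ≠ u ∧ (v = w ∨ (codeGraph C).Adj v w) := by
  have mem : ∀ {i : ι} {x : G}, x ≠ u.1 i → ∀ {l}, l ≠ i →
      ∃ v ∈ codeStar u i x, v ≠ u ∧ v.1 i = x ∧ AgreeOff v.1 u.1 i l := by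
    intro i x hx l hl
    obtain ⟨v, hv, h⟩ := hC.exists_agreeOff u hl.symm x
    exact ⟨v, Or.inr ⟨hv, l, hl, h⟩, fun e => hx (by rw [← hv, e]), hv, h⟩
  have key : ∀ {v w : C} {a b : ι}, a ≠ b → AgreeOff v.1 u.1 a b → AgreeOff w.1 u.1 a b →
      v = w ∨ (codeGraph C).Adj v w := by
    intro v w a b hab hv hw
    by_cases h : v = w
    · exact Or.inl h
    · exact Or.inr (hC.adj_of_agreeOff hab
        (fun t ht ht' => (hv t ht ht').trans (hw t ht ht').symm) h)
  rcases hL with ⟨k, l, hkl, rfl⟩ | ⟨k, y, hy, rfl⟩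
  · wlog hik : l ≠ i generalizing k l with H
    · rw [codeLine_comm]
      exact H l k hkl.symm (fun e => hik (fun e' => hkl (e.trans e'.symm)))
    obtain ⟨v, hv, hvu, hvi, hva⟩ := mem hx hik
    -- Since `w` copies the letter of `v` at `l`, the two can differ only at `i` and `k`.
    obtain ⟨w, hwl, hw⟩ := hC.exists_agreeOff u hkl.symm (v.1 l)
    have hvl : v.1 l ≠ u.1 l := fun e => hvu (hC.eq_of_agreeOff hva.swap e)
    refine ⟨v, hv, w, hw.swap, hvu, fun e => hvl (by rw [← hwl, e]), ?_⟩
    by_cases hki : k = i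
    · exact key hkl (hki ▸ hva) hw.swap
    · by_cases hvw : v = w
      · exact Or.inl hvw
      · refine Or.inr (hC.adj_of_agreeOff hki (fun t ht ht' => ?_) hvw)
        by_cases htl : t = l
        · rw [htl, hwl]
        · exact (hva t ht' htl).trans (hw t htl ht).symm
  · by_cases hik : i = k
    · subst hik
      obtain ⟨l, hl, -⟩ := hι i i
      obtain ⟨v, hv, hvu, hvi, hva⟩ := mem hx hl
      obtain ⟨w, hw, hwu, hwi, hwa⟩ := mem hy hl
      exact ⟨v, hv, w, hw, hvu, hwu, key hl.symm hva hwa⟩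
    · obtain ⟨v, hv, hvu, hvi, hva⟩ := mem hx (Ne.symm hik)
      obtain ⟨w, hw, hwu, hwi, hwa⟩ := mem hy hik
      exact ⟨v, hv, w, hw, hvu, hwu, key hik hva hwa.swap⟩

/-- Over alphabets with at least five letters, graph isomorphisms map lines to lines. -/
theorem exists_image_codeLine {κ H : Type*} [DecidableEq κ] {D : Set (κ → H)}
    (hC : IsLatin C) (hD : IsLatin D) (φ : codeGraph C ≃g codeGraph D)
    (hcard : Nat.card G = Nat.card H) (h5 : 5 ≤ Nat.card G) (hικ : Nat.card ι = Nat.card κ)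
    (u : C) {i j : ι} (hij : i ≠ j) :
    ∃ a b, a ≠ b ∧ φ '' codeLine u i j = codeLine (φ u) a b := by
  have img : ∀ {i j : ι}, i ≠ j → (φ '' codeLine u i j).ncard = Nat.card G := by
    intro i j hij
    rw [Set.ncard_image_of_injective _ φ.injective, hC.ncard_codeLine u hij]
  have cls : ∀ {i j : ι}, i ≠ j →
      (∃ a b, a ≠ b ∧ φ '' codeLine u i j = codeLine (φ u) a b) ∨
      ∃ a x, x ≠ (φ u).1 a ∧ φ '' codeLine u i j = codeStar (φ u) a x := by
    intro i j hij
    exact hD.eq_codeLine_or_codeStar ((hC.isMaxClique_codeLine (by omega) u hij).image φ)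
      (by rw [img hij]; exact h5) ⟨u, mem_codeLine_self u i j, rfl⟩
  refine (cls hij).resolve_right ?_
  rintro ⟨a, x, hx, he⟩
  have hq : Nat.card κ = Nat.card G := by rw [← img hij, he, hD.ncard_codeStar _ hx]
  -- If a line became a star, both codes would have length `|G| ≥ 5`, leaving room for a pair `k`,
  -- `l` disjoint from `i`, `j`. Points other than `u` on the two lines then differ at four
  -- positions.
  obtain ⟨k, hk⟩ := exists_notMem_of_card_lt ({i, j} : Finset ι)
    (lt_of_le_of_lt Finset.card_le_two (by omega))
  obtain ⟨l, hl⟩ := exists_notMem_of_card_lt ({i, j, k} : Finset ι)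
    (lt_of_le_of_lt Finset.card_le_three (by omega))
  simp only [Finset.mem_insert, Finset.mem_singleton, not_or] at hk hl
  have hκ : ∀ a b : κ, ∃ c, c ≠ a ∧ c ≠ b := by
    intro a b
    obtain ⟨c, hc⟩ := exists_notMem_of_card_lt ({a, b} : Finset κ)
      (lt_of_le_of_lt Finset.card_le_two (by omega))
    exact ⟨c, by simpa using hc⟩
  obtain ⟨v, hv, w, hw, hvu, hwu, h⟩ := hD.exists_adj_codeStar hκ hx (cls (Ne.symm hl.2.2))
  rw [← he] at hv
  obtain ⟨v, hv, rfl⟩ := hv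
  obtain ⟨w, hw, rfl⟩ := hw
  have hvu : v ≠ u := fun e => hvu (e ▸ rfl)
  have hwu : w ≠ u := fun e => hwu (e ▸ rfl)
  have h : v = w ∨ (codeGraph C).Adj v w :=
    h.imp (fun e => φ.injective e) (fun e => φ.map_adj_iff.1 e)
  have hvi : v.1 i ≠ u.1 i := fun e => hvu (hC.eq_of_agreeOff hv e)
  have hvj : v.1 j ≠ u.1 j := fun e => hvu (hC.eq_of_agreeOff (AgreeOff.swap hv) e)
  have hwk : w.1 k ≠ u.1 k := fun e => hwu (hC.eq_of_agreeOff hw e)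
  have h1 := hv k hk.1 hk.2
  have h2 := hw i (Ne.symm hk.1) (Ne.symm hl.1)
  have h3 := hw j (Ne.symm hk.2) (Ne.symm hl.2.1)
  rcases h with rfl | ⟨c, d, hcd, hc, hd, h⟩
  · exact hvi h2
  · rw [agreeOff_iff] at h
    have := h i
    have := h j
    have := h k
    grind

end LatinCode

/-! ### The words with product one and their identification with the Cayley graph -/

section GroupCode

variable {G : Type*} [Group G] {n : ℕ}

/-- The product of the first `k` letters of the word `d`. -/
def partProd (d : Fin n → G) : ℕ → G
  | 0 => 1
  | k + 1 => partProd d k * if h : k < n then d ⟨k, h⟩ else 1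

/-- The words of length `n` over `G` with product `1`. -/
def groupCode (G : Type*) [Group G] (n : ℕ) : Set (Fin n → G) := {d | partProd d n = 1}

theorem partProd_succ (d : Fin n → G) (k : Fin n) :
    partProd d (k + 1) = partProd d k * d k := by
  simp [partProd]

theorem letter_eq (d : Fin n → G) (k : Fin n) :
    d k = (partProd d k)⁻¹ * partProd d (k + 1) := by
  simp [partProd_succ]

/-- The quotient is the product of the letters at positions `s, …, t - 1`. -/
theorem partProd_congr {d d' : Fin n → G} {s t : ℕ} (hst : s ≤ t)
    (h : ∀ k : Fin n, s ≤ k → (k : ℕ) < t → d k = d' k) :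
    (partProd d s)⁻¹ * partProd d t = (partProd d' s)⁻¹ * partProd d' t := by
  induction t, hst using Nat.le_induction with
  | base => simp
  | succ t hst ih =>
    have ih := ih fun k hk hk' => h k hk (by omega)
    simp only [partProd]
    split_ifs with ht
    · rw [← mul_assoc, ← mul_assoc, ih, h ⟨t, ht⟩ hst (by simp)]
    · simpa using ih

theorem partProd_const {d : Fin n → G} {s t : ℕ} (hst : s ≤ t)
    (h : ∀ k : Fin n, s ≤ k → (k : ℕ) < t → d k = 1) : partProd d t = partProd d s := by
  induction t, hst using Nat.le_induction with
  | base => rfl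
  | succ t hst ih =>
    rw [← ih fun k hk hk' => h k hk (by omega)]
    simp only [partProd]
    split_ifs with ht
    · rw [h ⟨t, ht⟩ hst (by simp), mul_one]
    · simp

theorem partProd_one (k : ℕ) : partProd (1 : Fin n → G) k = 1 :=
  partProd_const (Nat.zero_le k) fun _ _ _ => rfl

theorem one_mem_groupCode : (1 : Fin n → G) ∈ groupCode G n := partProd_one n

theorem partProd_update (w : Fin n → G) (i : Fin n) (x : G) :
    partProd (Function.update w i x) n =
      partProd w i * x * ((partProd w (i + 1))⁻¹ * partProd w n) := by
  have h1 : partProd (Function.update w i x) i = partProd w i := by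
    have := partProd_congr (d := Function.update w i x) (d' := w) (Nat.zero_le (i : ℕ))
      fun k _ hk => Function.update_of_ne (by rintro rfl; exact lt_irrefl _ hk) _ _
    simpa [partProd] using this
  have h2 := partProd_congr (d := Function.update w i x) (d' := w) (Nat.succ_le_of_lt i.2)
      fun k hk _ => Function.update_of_ne (by rintro rfl; omega) _ _
  rw [Nat.succ_eq_add_one] at h2
  rw [← h2, partProd_succ (Function.update w i x), h1, Function.update_self]
  group

theorem isLatin_groupCode : IsLatin (groupCode G n) := by
  intro w i
  refine ⟨(partProd w i)⁻¹ * ((partProd w (i + 1))⁻¹ * partProd w n)⁻¹, ?_, ?_⟩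
  · change partProd _ n = 1
    rw [partProd_update]; group
  · intro y hy
    change partProd (Function.update w i y) n = 1 at hy
    rw [partProd_update, mul_eq_one_iff_eq_inv] at hy
    rw [← hy]; group

theorem partProd_triple {d : Fin n → G} {a b c : Fin n} (hab : a < b) (hbc : b < c)
    (h : ∀ k, k ≠ a → k ≠ b → k ≠ c → d k = 1) : partProd d n = d a * d b * d c := by
  have hab' : (a : ℕ) < b := hab
  have hbc' : (b : ℕ) < c := hbc
  have h4 : partProd d n = partProd d (c + 1) := partProd_const (Nat.succ_le_of_lt c.2)
    fun k hk _ => h k (by rintro rfl; omega) (by rintro rfl; omega) (by rintro rfl; omega)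
  have h3 : partProd d c = partProd d (b + 1) := partProd_const (by omega)
    fun k hk _ => h k (by rintro rfl; omega) (by rintro rfl; omega) (by rintro rfl; omega)
  have h2 : partProd d b = partProd d (a + 1) := partProd_const (by omega)
    fun k hk _ => h k (by rintro rfl; omega) (by rintro rfl; omega) (by rintro rfl; omega)
  have h1 : partProd d a = 1 := partProd_const (Nat.zero_le _)
    fun k hk _ => h k (by rintro rfl; omega) (by rintro rfl; omega) (by rintro rfl; omega)
  rw [h4, partProd_succ, h3, partProd_succ, h2, partProd_succ, h1, one_mul]

/-- For words supported on three positions, membership in the code is a condition on the product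
of the three letters, in cyclic or in reverse cyclic order. -/
theorem groupCode_triple {a b c : Fin n} (hab : a ≠ b) (hac : a ≠ c) (hbc : b ≠ c) :
    (∀ d : groupCode G n, (∀ k, k ≠ a → k ≠ b → k ≠ c → d.1 k = 1) →
      d.1 a * d.1 b * d.1 c = 1) ∨
    (∀ d : groupCode G n, (∀ k, k ≠ a → k ≠ b → k ≠ c → d.1 k = 1) →
      d.1 c * d.1 b * d.1 a = 1) := by
  have cyc : ∀ {x y z : G}, x * y * z = 1 → y * z * x = 1 := by
    intro x y z h
    rw [mul_assoc] at h
    exact mul_eq_one_comm.1 h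
  have key : ∀ {a b c : Fin n}, a < b → b < c → ∀ d : groupCode G n,
      (∀ k, k ≠ a → k ≠ b → k ≠ c → d.1 k = 1) → d.1 a * d.1 b * d.1 c = 1 :=
    fun h1 h2 d hd => (partProd_triple h1 h2 hd).symm.trans d.2
  rcases lt_or_gt_of_ne hab with h1 | h1 <;> rcases lt_or_gt_of_ne hac with h2 | h2 <;>
    rcases lt_or_gt_of_ne hbc with h3 | h3
  · exact Or.inl fun d hd => key h1 h3 d hd
  · exact Or.inr fun d hd => cyc (key h2 h3 d fun k k1 k2 k3 => hd k k1 k3 k2)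
  · exact absurd (h1.trans h3) (lt_asymm h2)
  · exact Or.inl fun d hd => cyc (key h2 h1 d fun k k1 k2 k3 => hd k k2 k3 k1)
  · exact Or.inr fun d hd => cyc (cyc (key h1 h2 d fun k k1 k2 k3 => hd k k2 k1 k3))
  · exact absurd (h1.trans h2) (lt_asymm h3)
  · exact Or.inl fun d hd => cyc (cyc (key h3 h2 d fun k k1 k2 k3 => hd k k3 k1 k2))
  · exact Or.inr fun d hd => key h3 h1 d fun k k1 k2 k3 => hd k k3 k2 k1

variable {m : ℕ}

/-- The tuple of the proper partial products of a codeword. -/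
def codeTuple (d : groupCode G (m + 1)) : Fin m → G := fun i => partProd d.1 (i + 1)

theorem bijective_codeTuple :
    Function.Bijective (codeTuple : groupCode G (m + 1) → Fin m → G) := by
  constructor
  · intro d d' h
    have key : ∀ k ≤ m + 1, partProd d.1 k = partProd d'.1 k := by
      intro k hk
      rcases Nat.eq_zero_or_pos k with rfl | hk0
      · rfl
      rcases Nat.eq_or_lt_of_le hk with rfl | hk1
      · exact d.2.trans d'.2.symm
      · have := congrFun h ⟨k - 1, by omega⟩
        simpa [codeTuple, Nat.sub_add_cancel hk0] using this
    apply Subtype.ext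
    funext k
    rw [letter_eq d.1, letter_eq d'.1, key k (by omega), key (k + 1) (by omega)]
  · intro g
    -- The prescribed partial products; the default value `1` serves the two ends `0` and `m + 1`.
    let e : ℕ → G := fun k => if h : 1 ≤ k ∧ k ≤ m then g ⟨k - 1, by omega⟩ else 1
    let d : Fin (m + 1) → G := fun k => (e k)⁻¹ * e (k + 1)
    have key : ∀ k ≤ m + 1, partProd d k = e k := by
      intro k
      induction k with
      | zero => intro _; simp [partProd, e]
      | succ k ih =>
        intro hk
        have := partProd_succ d ⟨k, by omega⟩
        simp only at this
        rw [this, ih (by omega)]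
        simp [d]
    refine ⟨⟨d, ?_⟩, ?_⟩
    · change partProd d (m + 1) = 1
      rw [key _ le_rfl]; simp [e]
    · funext i
      change partProd d (i + 1) = g i
      rw [key _ (by omega)]
      have : (i : ℕ) + 1 ≤ m := i.2
      simp [e, this]

theorem codeTuple_adj_iff (d d' : groupCode G (m + 1)) :
    (intervalCayGraph m G).Adj (codeTuple d) (codeTuple d') ↔
      (codeGraph (groupCode G (m + 1))).Adj d d' := by
  constructor
  · rintro ⟨s, ⟨x, k, l, hx, hk, hkl, hl, rfl⟩, h⟩
    have key : ∀ t ≤ m + 1, partProd d'.1 t = (if k ≤ t ∧ t < l then x else 1) * partProd d.1 t := by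
      intro t ht
      rcases Nat.eq_zero_or_pos t with rfl | ht0
      · simp [partProd]; omega
      rcases Nat.eq_or_lt_of_le ht with rfl | ht1
      · rw [if_neg (by omega), one_mul]
        exact d'.2.trans d.2.symm
      · have := congrFun h ⟨t - 1, by omega⟩
        simpa [codeTuple, intervalElem, Nat.sub_add_cancel ht0] using this
    have val : ∀ t : Fin (m + 1), d'.1 t = (partProd d.1 t)⁻¹ *
        ((if k ≤ (t : ℕ) ∧ (t : ℕ) < l then x else 1)⁻¹ *
        (if k ≤ (t : ℕ) + 1 ∧ (t : ℕ) + 1 < l then x else 1)) * partProd d.1 (t + 1) := by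
      intro t
      rw [letter_eq d'.1, key _ (by omega), key _ (by omega)]
      group
    -- Inside the interval the factor `x` cancels between consecutive partial products; only the
    -- letters at which the interval begins and ends change.
    refine ⟨⟨k - 1, by omega⟩, ⟨l - 1, by omega⟩, ?_, ?_, ?_, ?_⟩
    · simp only [ne_eq, Fin.mk.injEq]; omega
    · rw [val, letter_eq d.1]
      simp only
      rw [if_neg (by omega), if_pos (by omega)]
      simp [hx]
    · rw [val, letter_eq d.1]
      simp only
      rw [if_pos (by omega), if_neg (by omega)]
      simp [hx]
    · intro t ht ht'
      simp only [ne_eq, Fin.ext_iff] at ht ht'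
      rw [val, letter_eq d.1]
      by_cases h1 : k ≤ (t : ℕ) ∧ (t : ℕ) < l
      · rw [if_pos h1, if_pos (by omega)]; simp
      · rw [if_neg h1, if_neg (by omega)]; simp
  · intro hadj
    obtain ⟨a, b, hab, ha, hb, h⟩ : ∃ a b : Fin (m + 1), a < b ∧ d.1 a ≠ d'.1 a ∧
        d.1 b ≠ d'.1 b ∧ AgreeOff d.1 d'.1 a b := by
      obtain ⟨a, b, hab, ha, hb, h⟩ := hadj
      rcases lt_or_gt_of_ne hab with h' | h'
      · exact ⟨a, b, h', ha, hb, h⟩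
      · exact ⟨b, a, h', hb, ha, h.swap⟩
    have hab' : (a : ℕ) < b := hab
    have h1 : ∀ t ≤ (a : ℕ), partProd d.1 t = partProd d'.1 t := by
      intro t ht
      simpa [partProd] using partProd_congr (d := d.1) (d' := d'.1) (Nat.zero_le t)
        fun k _ hk => h k (by rintro rfl; omega) (by rintro rfl; omega)
    have h2 : ∀ t, (a : ℕ) + 1 ≤ t → t ≤ b → (partProd d.1 (a + 1))⁻¹ * partProd d.1 t =
        (partProd d'.1 (a + 1))⁻¹ * partProd d'.1 t := fun t ht ht' =>
      partProd_congr ht fun k hk hk' => h k (by rintro rfl; omega) (by rintro rfl; omega)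
    have h3 : ∀ t, (b : ℕ) + 1 ≤ t → t ≤ m + 1 → partProd d.1 t = partProd d'.1 t := by
      intro t ht ht'
      have := partProd_congr (d := d.1) (d' := d'.1) ht'
        fun k hk hk' => h k (by rintro rfl; omega) (by rintro rfl; omega)
      rw [show partProd d.1 (m + 1) = 1 from d.2, show partProd d'.1 (m + 1) = 1 from d'.2] at this
      simpa using this
    -- Between the two changed letters the ratio of the partial products of `d'` and `d` is
    -- constant, equal to its value right after position `a`; elsewhere it is `1`.
    refine ⟨intervalElem m (partProd d'.1 (a + 1) * (partProd d.1 (a + 1))⁻¹) (a + 1) (b + 1),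
      ⟨_, _, _, ?_, by omega, by omega, by omega, rfl⟩, ?_⟩
    · intro e
      apply ha
      rw [letter_eq d.1, letter_eq d'.1, h1 a le_rfl, mul_inv_eq_one.1 e]
    · funext i
      simp only [codeTuple, Pi.mul_apply, intervalElem]
      split_ifs with hi
      · rw [mul_assoc, h2 _ hi.1 (by omega)]; group
      · rw [one_mul]
        by_cases hia : (i : ℕ) + 1 ≤ a
        · exact (h1 _ hia).symm
        · exact (h3 _ (by omega) (by omega)).symm

/-- The graph `𝒢_m(G)` is isomorphic to the graph of the words of length `m + 1` with product `1`
in which two words are adjacent iff they differ at exactly two positions. -/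
noncomputable def codeGraphIso (G : Type*) [Group G] (m : ℕ) :
    codeGraph (groupCode G (m + 1)) ≃g intervalCayGraph m G where
  toEquiv := Equiv.ofBijective codeTuple bijective_codeTuple
  map_rel_iff' := codeTuple_adj_iff _ _

theorem codeGraphIso_one : codeGraphIso G m ⟨1, one_mem_groupCode⟩ = 1 := by
  funext i
  exact partProd_one _

/-- Right multiplication as an automorphism of `𝒢_m(G)`. -/
def intervalCayGraphMulRight (t : Fin m → G) : intervalCayGraph m G ≃g intervalCayGraph m G where
  toEquiv := Equiv.mulRight t
  map_rel_iff' := by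
    intro g h
    change (∃ s ∈ _, _ = _) ↔ (∃ s ∈ _, _ = _)
    simp only [Equiv.coe_mulRight, ← mul_assoc, mul_left_inj]

/-- Edges come from left multiplication, so right multiplications are automorphisms and can move the
image of `1` back to `1`. -/
theorem exists_codeGraph_iso {H : Type*} [Group H]
    (ψ : intervalCayGraph m G ≃g intervalCayGraph m H) :
    ∃ φ : codeGraph (groupCode G (m + 1)) ≃g codeGraph (groupCode H (m + 1)),
      φ ⟨1, one_mem_groupCode⟩ = ⟨1, one_mem_groupCode⟩ := by
  refine ⟨((codeGraphIso G m).trans (ψ.trans (intervalCayGraphMulRight (ψ 1)⁻¹))).trans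
    (codeGraphIso H m).symm, ?_⟩
  have : (codeGraphIso H m).symm 1 = ⟨1, one_mem_groupCode⟩ := by
    rw [← codeGraphIso_one, RelIso.symm_apply_apply]
  rw [← this]
  simp [RelIso.trans_apply, codeGraphIso_one, intervalCayGraphMulRight]

end GroupCode

/-! ### Isomorphisms on the plane spanned by three positions -/

section Plane

variable {ι κ G H : Type*} [DecidableEq ι] [DecidableEq κ] {C : Set (ι → G)} {D : Set (κ → H)}

/-- Adjacent points on two lines through a third point: the lines share a direction, and if they
share only one then the points agree there. -/
theorem IsLatin.lines_meet (hC : IsLatin C) {u v w : C} {a b c d : ι} (hab : a ≠ b)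
    (hcd : c ≠ d) (hv : v ∈ codeLine u a b) (hw : w ∈ codeLine u c d) (hvu : v ≠ u)
    (hwu : w ≠ u) (hvw : (codeGraph C).Adj v w) :
    (c = a ∨ c = b ∨ d = a ∨ d = b) ∧ (c = a → d ≠ b → v.1 a = w.1 a) := by
  have hva : v.1 a ≠ u.1 a := fun e => hvu (hC.eq_of_agreeOff hv e)
  have hvb : v.1 b ≠ u.1 b := fun e => hvu (hC.eq_of_agreeOff (AgreeOff.swap hv) e)
  have hwc : w.1 c ≠ u.1 c := fun e => hwu (hC.eq_of_agreeOff hw e)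
  have hwd : w.1 d ≠ u.1 d := fun e => hwu (hC.eq_of_agreeOff (AgreeOff.swap hw) e)
  obtain ⟨e, f, hef, he, hf, h⟩ := hvw
  have hv : AgreeOff v.1 u.1 a b := hv
  have hw : AgreeOff w.1 u.1 c d := hw
  rw [agreeOff_iff] at hv hw h
  have := hv c
  have := hv d
  have := hw a
  have := hw b
  have := h a
  have := h b
  have := h c
  have := h d
  constructor <;> grind

/-- If the three lines in a plane through `u` map to the three lines in a plane, then the value of
`φ p` at `c` is determined by the value of `p` at `k`. -/
theorem image_plane (hC : IsLatin C) (hD : IsLatin D) (φ : codeGraph C ≃g codeGraph D)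
    (hline : ∀ (u : C) {i j : ι}, i ≠ j →
      ∃ a b, a ≠ b ∧ φ '' codeLine u i j = codeLine (φ u) a b)
    {u : C} {i j k : ι} {a b c : κ} (hij : i ≠ j) (hik : i ≠ k) (hjk : j ≠ k)
    (hab : a ≠ b) (hac : a ≠ c) (hbc : b ≠ c)
    (lij : φ '' codeLine u i j = codeLine (φ u) a b)
    (lik : φ '' codeLine u i k = codeLine (φ u) a c)
    (ljk : φ '' codeLine u j k = codeLine (φ u) b c)
    {p p' : C} (hp : ∀ t, t ≠ i → t ≠ j → t ≠ k → p.1 t = u.1 t)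
    (hp' : ∀ t, t ≠ i → t ≠ j → t ≠ k → p'.1 t = u.1 t) (hpp : p.1 k = p'.1 k) :
    (φ p).1 c = (φ p').1 c ∧ ∀ t, t ≠ a → t ≠ b → t ≠ c → (φ p).1 t = (φ u).1 t := by
  by_cases hk : p.1 k = u.1 k
  · have mem : ∀ q : C, (∀ t, t ≠ i → t ≠ j → t ≠ k → q.1 t = u.1 t) → q.1 k = u.1 k →
        φ q ∈ codeLine (φ u) a b := by
      intro q hq hqk
      rw [← lij]
      refine ⟨q, fun t ht ht' => ?_, rfl⟩
      by_cases htk : t = k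
      · rw [htk, hqk]
      · exact hq t ht ht' htk
    have h1 := mem p hp hk
    have h2 := mem p' hp' (hpp.symm.trans hk)
    exact ⟨(h1 c hac.symm hbc.symm).trans (h2 c hac.symm hbc.symm).symm,
      fun t ht ht' _ => h1 t ht ht'⟩
  -- The line through `p` in directions `i`, `j` meets the other two lines of the plane through `u`
  -- in `p₁` and `p₂`. Their images differ at `a` and at `b`, so the image line has directions `a`,
  -- `b`, and the letter at `c` is constant on it.
  · obtain ⟨p₁, e1, h1⟩ := hC.exists_agreeOff p hij.symm (u.1 j)
    obtain ⟨p₂, e2, h2⟩ := hC.exists_agreeOff p hij (u.1 i)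
    obtain ⟨e, f, hef, hl⟩ := hline p hij
    have k1 : p₁.1 k = p.1 k := h1 k hjk.symm hik.symm
    have k2 : p₂.1 k = p.1 k := h2 k hik.symm hjk.symm
    have ne1 : p₁ ≠ u := fun h => hk (by rw [← k1, h])
    have ne2 : p₂ ≠ u := fun h => hk (by rw [← k2, h])
    have m1 : φ p₁ ∈ codeLine (φ u) a c := by
      rw [← lik]
      refine ⟨p₁, fun t ht ht' => ?_, rfl⟩
      by_cases htj : t = j
      · rw [htj, e1]
      · exact (h1 t htj ht).trans (hp t ht htj ht')
    have m2 : φ p₂ ∈ codeLine (φ u) b c := by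
      rw [← ljk]
      refine ⟨p₂, fun t ht ht' => ?_, rfl⟩
      by_cases hti : t = i
      · rw [hti, e2]
      · exact (h2 t hti ht).trans (hp t hti ht ht')
    have n1 : (φ p₁).1 a ≠ (φ u).1 a := fun h => ne1 (φ.injective (hD.eq_of_agreeOff m1 h))
    have n2 : (φ p₂).1 b ≠ (φ u).1 b := fun h => ne2 (φ.injective (hD.eq_of_agreeOff m2 h))
    have l1 : φ p₁ ∈ codeLine (φ p) e f := hl ▸ ⟨p₁, AgreeOff.swap h1, rfl⟩
    have l2 : φ p₂ ∈ codeLine (φ p) e f := hl ▸ ⟨p₂, h2, rfl⟩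
    have l3 : φ p' ∈ codeLine (φ p) e f := by
      rw [← hl]
      refine ⟨p', fun t ht ht' => ?_, rfl⟩
      by_cases htk : t = k
      · rw [htk, hpp]
      · exact (hp' t ht ht' htk).trans (hp t ht ht' htk).symm
    have ha : a = e ∨ a = f := by
      by_contra! hcon
      exact n1 (((l1 a hcon.1 hcon.2).trans (l2 a hcon.1 hcon.2).symm).trans (m2 a hab hac))
    have hb : b = e ∨ b = f := by
      by_contra! hcon
      exact n2 (((l2 b hcon.1 hcon.2).trans (l1 b hcon.1 hcon.2).symm).trans
        (m1 b hab.symm hbc))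
    have hlab : codeLine (φ p) e f = codeLine (φ p) a b := by
      rcases ha with rfl | rfl <;> rcases hb with rfl | rfl
      · exact absurd rfl hab
      · rfl
      · exact codeLine_comm _ _ _
      · exact absurd rfl hab
    rw [hlab] at l1 l2 l3
    exact ⟨(l3 c hac.symm hbc.symm).symm,
      fun t ht ht' ht'' => (l1 t ht ht').symm.trans (m1 t ht ht'')⟩

end Plane

/-! ### Recovering the group from an isomorphism that preserves lines -/

section Recover

variable {G H : Type*} [Group G] [Group H] {n : ℕ}

/-- The word with letters `x`, `y`, `z` at positions `i`, `j`, `k` and `1` elsewhere. -/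
def tripleWord (i j k : Fin n) (x y z : G) : Fin n → G :=
  fun t => if t = i then x else if t = j then y else if t = k then z else 1

theorem tripleWord_mem {i j k : Fin n} (hij : i < j) (hjk : j < k) {x y z : G}
    (h : x * y * z = 1) : tripleWord i j k x y z ∈ groupCode G n := by
  change partProd _ n = 1
  rw [partProd_triple hij hjk]
  · simpa [tripleWord, hij.ne', hjk.ne', (hij.trans hjk).ne'] using h
  · intro t h1 h2 h3
    simp [tripleWord, h1, h2, h3]

/-- Putting `1` in one slot shows that `f` and `g` agree and that `h x⁻¹` is the inverse of `f x`;
the relation for `x`, `y`, `(x * y)⁻¹` is then multiplicativity. -/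
theorem map_mul_of_triple {f g h : G → H} (hf : f 1 = 1) (hg : g 1 = 1) (hh : h 1 = 1)
    (H3 : ∀ x y z, x * y * z = 1 → f x * g y * h z = 1) (x y : G) : f (x * y) = f x * f y := by
  have h1 : ∀ x, f x * g x⁻¹ = 1 := fun x => by simpa [hh] using H3 x x⁻¹ 1 (by simp)
  have h2 : ∀ x, f x * h x⁻¹ = 1 := fun x => by simpa [hg] using H3 x 1 x⁻¹ (by simp)
  have h3 : ∀ x, g x * h x⁻¹ = 1 := fun x => by simpa [hf] using H3 1 x x⁻¹ (by simp)
  have e1 : f y = g y := mul_right_cancel ((h2 y).trans (h3 y).symm)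
  have e2 := H3 x y (x * y)⁻¹ (by group)
  rw [← e1] at e2
  exact (mul_right_cancel (e2.trans (h2 (x * y)).symm)).symm

/-- If `G` has an element of order greater than two, then three coplanar lines through `1` have
coplanar images under an isomorphism that maps lines to lines. -/
theorem exists_coplanar (φ : codeGraph (groupCode G n) ≃g codeGraph (groupCode H n))
    (hφ : φ ⟨1, one_mem_groupCode⟩ = ⟨1, one_mem_groupCode⟩)
    (hline : ∀ (u : groupCode G n) {i j : Fin n}, i ≠ j →
      ∃ a b, a ≠ b ∧ φ '' codeLine u i j = codeLine (φ u) a b)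
    {x : G} (hx : x * x ≠ 1) {i j k : Fin n} (hij : i < j) (hjk : j < k) :
    ∃ a b c : Fin n, a ≠ b ∧ a ≠ c ∧ b ≠ c ∧
      φ '' codeLine ⟨1, one_mem_groupCode⟩ i j = codeLine ⟨1, one_mem_groupCode⟩ a b ∧
      φ '' codeLine ⟨1, one_mem_groupCode⟩ i k = codeLine ⟨1, one_mem_groupCode⟩ a c ∧
      φ '' codeLine ⟨1, one_mem_groupCode⟩ j k = codeLine ⟨1, one_mem_groupCode⟩ b c := by
  have hik := hij.trans hjk
  have hx1 : x ≠ 1 := by rintro rfl; simp at hx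
  have hxx : x ≠ x⁻¹ := fun e => hx (by nth_rewrite 2 [e]; simp)
  set o : groupCode G n := ⟨1, one_mem_groupCode⟩ with ho
  set o' : groupCode H n := ⟨1, one_mem_groupCode⟩ with ho'
  -- A path `p, q, r, s` that visits the three lines and returns to the first one at a different
  -- point, because `x ≠ x⁻¹`.
  let p : groupCode G n := ⟨_, tripleWord_mem hij hjk (x := x) (y := x⁻¹) (z := 1) (by simp)⟩
  let q : groupCode G n := ⟨_, tripleWord_mem hij hjk (x := x) (y := 1) (z := x⁻¹) (by simp)⟩
  let r : groupCode G n := ⟨_, tripleWord_mem hij hjk (x := 1) (y := x) (z := x⁻¹) (by simp)⟩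
  let s : groupCode G n := ⟨_, tripleWord_mem hij hjk (x := x⁻¹) (y := x) (z := 1) (by simp)⟩
  have pi : p.1 i = x := by simp [p, tripleWord]
  have pj : p.1 j = x⁻¹ := by simp [p, tripleWord, hij.ne']
  have pk : p.1 k = 1 := by simp [p, tripleWord, hik.ne', hjk.ne']
  have qi : q.1 i = x := by simp [q, tripleWord]
  have qj : q.1 j = 1 := by simp [q, tripleWord, hij.ne']
  have qk : q.1 k = x⁻¹ := by simp [q, tripleWord, hik.ne', hjk.ne']
  have ri : r.1 i = 1 := by simp [r, tripleWord]
  have rj : r.1 j = x := by simp [r, tripleWord, hij.ne']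
  have rk : r.1 k = x⁻¹ := by simp [r, tripleWord, hik.ne', hjk.ne']
  have si : s.1 i = x⁻¹ := by simp [s, tripleWord]
  have sj : s.1 j = x := by simp [s, tripleWord, hij.ne']
  have sk : s.1 k = 1 := by simp [s, tripleWord, hik.ne', hjk.ne']
  have oo : ∀ t, o.1 t = 1 := fun t => rfl
  have hp : ∀ t, t ≠ i → t ≠ j → t ≠ k → p.1 t = 1 :=
    fun t h1 h2 h3 => by simp [p, tripleWord, h1, h2, h3]
  have hq : ∀ t, t ≠ i → t ≠ j → t ≠ k → q.1 t = 1 :=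
    fun t h1 h2 h3 => by simp [q, tripleWord, h1, h2, h3]
  have hr : ∀ t, t ≠ i → t ≠ j → t ≠ k → r.1 t = 1 :=
    fun t h1 h2 h3 => by simp [r, tripleWord, h1, h2, h3]
  have hs : ∀ t, t ≠ i → t ≠ j → t ≠ k → s.1 t = 1 :=
    fun t h1 h2 h3 => by simp [s, tripleWord, h1, h2, h3]
  clear_value p q r s o o'
  have mp : p ∈ codeLine o i j := fun t h1 h2 => by
    by_cases h3 : t = k
    · rw [h3, pk, oo]
    · rw [hp t h1 h2 h3, oo]
  have ms : s ∈ codeLine o i j := fun t h1 h2 => by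
    by_cases h3 : t = k
    · rw [h3, sk, oo]
    · rw [hs t h1 h2 h3, oo]
  have mq : q ∈ codeLine o i k := fun t h1 h2 => by
    by_cases h3 : t = j
    · rw [h3, qj, oo]
    · rw [hq t h1 h3 h2, oo]
  have mr : r ∈ codeLine o j k := fun t h1 h2 => by
    by_cases h3 : t = i
    · rw [h3, ri, oo]
    · rw [hr t h3 h1 h2, oo]
  have apq : (codeGraph _).Adj p q := by
    refine ⟨j, k, hjk.ne, by simp [pj, qj, hx1], by simp [pk, qk, hx1], fun t h1 h2 => ?_⟩
    by_cases h3 : t = i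
    · rw [h3, pi, qi]
    · rw [hp t h3 h1 h2, hq t h3 h1 h2]
  have aqr : (codeGraph _).Adj q r := by
    refine ⟨i, j, hij.ne, by simp [qi, ri, hx1], by simp [qj, rj, hx1.symm], fun t h1 h2 => ?_⟩
    by_cases h3 : t = k
    · rw [h3, qk, rk]
    · rw [hq t h1 h2 h3, hr t h1 h2 h3]
  have ars : (codeGraph _).Adj r s := by
    refine ⟨i, k, hik.ne, by simp [ri, si, hx1], by simp [rk, sk, hx1], fun t h1 h2 => ?_⟩
    by_cases h3 : t = j
    · rw [h3, rj, sj]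
    · rw [hr t h1 h3 h2, hs t h1 h3 h2]
  have np : φ p ≠ o' := fun e => hx1 (by rw [← pi, φ.injective (e.trans hφ.symm), oo])
  have nq : φ q ≠ o' := fun e => hx1 (by rw [← qi, φ.injective (e.trans hφ.symm), oo])
  have nr : φ r ≠ o' := fun e => hx1 (by rw [← rj, φ.injective (e.trans hφ.symm), oo])
  have ns : φ s ≠ o' := fun e => hx1 (by rw [← sj, φ.injective (e.trans hφ.symm), oo])
  have apq := φ.map_adj_iff.2 apq
  have aqr := φ.map_adj_iff.2 aqr
  have ars := φ.map_adj_iff.2 ars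
  have d12 : φ '' codeLine o i j ≠ φ '' codeLine o i k := fun e => by
    rw [φ.injective.image_injective.eq_iff] at e
    rw [e] at mp
    exact hx1 (by simpa [pj, oo] using mp j hij.ne' hjk.ne)
  have d13 : φ '' codeLine o i j ≠ φ '' codeLine o j k := fun e => by
    rw [φ.injective.image_injective.eq_iff] at e
    rw [e] at mp
    exact hx1 (by simpa [pi, oo] using mp i hij.ne hik.ne)
  have d23 : φ '' codeLine o i k ≠ φ '' codeLine o j k := fun e => by
    rw [φ.injective.image_injective.eq_iff] at e
    rw [e] at mq
    exact hx1 (by simpa [qi, oo] using mq i hij.ne hik.ne)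
  have mp := Set.mem_image_of_mem φ mp
  have mq := Set.mem_image_of_mem φ mq
  have mr := Set.mem_image_of_mem φ mr
  have ms := Set.mem_image_of_mem φ ms
  have hL := @isLatin_groupCode H _ n
  obtain ⟨a₁, b₁, n1, l1⟩ := hline o hij.ne
  obtain ⟨a₂, b₂, n2, l2⟩ := hline o hik.ne
  obtain ⟨a₃, b₃, n3, l3⟩ := hline o hjk.ne
  rw [hφ] at l1 l2 l3
  obtain ⟨a, b, c, hab, hac, l1, l2⟩ : ∃ a b c, a ≠ b ∧ a ≠ c ∧
      φ '' codeLine o i j = codeLine o' a b ∧ φ '' codeLine o i k = codeLine o' a c := by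
    rcases (hL.lines_meet n1 n2 (l1 ▸ mp) (l2 ▸ mq) np nq apq).1 with rfl | rfl | rfl | rfl
    · exact ⟨_, _, _, n1, n2, l1, l2⟩
    · exact ⟨_, _, _, n1.symm, n2, l1.trans (codeLine_comm _ _ _), l2⟩
    · exact ⟨_, _, _, n1, n2.symm, l1, l2.trans (codeLine_comm _ _ _)⟩
    · exact ⟨_, _, _, n1.symm, n2.symm, l1.trans (codeLine_comm _ _ _),
        l2.trans (codeLine_comm _ _ _)⟩
  have hbc : b ≠ c := by
    rintro rfl
    exact d12 (l1.trans l2.symm)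
  refine ⟨a, b, c, hab, hac, hbc, l1, l2, ?_⟩
  rw [l1, l2] at d12
  rw [l1] at d13 mp ms
  rw [l2] at d23 mq
  obtain ⟨e, f, hef, l3, he⟩ : ∃ e f, e ≠ f ∧ φ '' codeLine o j k = codeLine o' e f ∧
      (e = a ∨ e = c) := by
    rcases (hL.lines_meet hac n3 mq (l3 ▸ mr) nq nr aqr).1 with h | h | h | h
    · exact ⟨_, _, n3, l3, Or.inl h⟩
    · exact ⟨_, _, n3, l3, Or.inr h⟩
    · exact ⟨_, _, n3.symm, l3.trans (codeLine_comm _ _ _), Or.inl h⟩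
    · exact ⟨_, _, n3.symm, l3.trans (codeLine_comm _ _ _), Or.inr h⟩
  rw [l3] at d13 d23 mr ⊢
  rcases he with rfl | rfl
  -- If all three image lines shared the direction `a`, the letter at `a` would be constant along
  -- the path, so `p` and `s` would have the same image.
  · exfalso
    have hfb : f ≠ b := by rintro rfl; exact d13 rfl
    have hfc : f ≠ c := by rintro rfl; exact d23 rfl
    have v1 := (hL.lines_meet hab hac mp mq np nq apq).2 rfl hbc.symm
    have v2 := (hL.lines_meet hac hef mq mr nq nr aqr).2 rfl hfc
    have v3 := (hL.lines_meet hef hab mr ms nr ns ars).2 rfl hfb.symm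
    have : φ p = φ s := hL.eq_of_agreeOff (i := e) (j := b)
      (fun t ht ht' => (mp t ht ht').trans (ms t ht ht').symm) ((v1.trans v2).trans v3)
    have hps := congrArg (fun w : groupCode G n => w.1 i) (φ.injective this)
    exact hxx (pi.symm.trans (hps.trans si))
  · have hm := (hL.lines_meet hef hab mr ms nr ns ars).1
    have hfa : f ≠ a := by
      rintro rfl
      exact d23 (codeLine_comm _ _ _)
    have : f = b := by
      rcases hm with h | h | h | h
      · exact absurd h hac
      · exact absurd h.symm hfa
      · exact absurd h hbc
      · exact h.symm
    rw [this, codeLine_comm]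

/-- A group with an element of order greater than two is determined by the graph, provided that
lines map to lines. -/
theorem nonempty_mulEquiv_of_lines [Finite G]
    (φ : codeGraph (groupCode G n) ≃g codeGraph (groupCode H n))
    (hφ : φ ⟨1, one_mem_groupCode⟩ = ⟨1, one_mem_groupCode⟩)
    (hline : ∀ (u : groupCode G n) {i j : Fin n}, i ≠ j →
      ∃ a b, a ≠ b ∧ φ '' codeLine u i j = codeLine (φ u) a b)
    (hcard : Nat.card G = Nat.card H) (hx : ∃ x : G, x * x ≠ 1) (hn : 3 ≤ n) :
    Nonempty (G ≃* H) := by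
  obtain ⟨x₀, hx₀⟩ := hx
  have : Finite H := Nat.finite_of_card_ne_zero (by rw [← hcard]; exact Nat.card_pos.ne')
  let i : Fin n := ⟨0, by omega⟩
  let j : Fin n := ⟨1, by omega⟩
  let k : Fin n := ⟨2, by omega⟩
  have hij : i < j := by simp [i, j, Fin.lt_def]
  have hjk : j < k := by simp [j, k, Fin.lt_def]
  have hik := hij.trans hjk
  obtain ⟨a, b, c, hab, hac, hbc, l1, l2, l3⟩ := exists_coplanar φ hφ hline hx₀ hij hjk
  let W : ∀ x y z : G, x * y * z = 1 → groupCode G n := fun x y z h =>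
    ⟨tripleWord i j k x y z, tripleWord_mem hij hjk h⟩
  have Wi : ∀ x y z h, (W x y z h).1 i = x := fun x y z h => by simp [W, tripleWord]
  have Wj : ∀ x y z h, (W x y z h).1 j = y := fun x y z h => by simp [W, tripleWord, hij.ne']
  have Wk : ∀ x y z h, (W x y z h).1 k = z := fun x y z h => by
    simp [W, tripleWord, hjk.ne', hik.ne']
  have Wt : ∀ x y z h t, t ≠ i → t ≠ j → t ≠ k → (W x y z h).1 t = 1 :=
    fun x y z h t h1 h2 h3 => by simp [W, tripleWord, h1, h2, h3]
  have W1 : ∀ h, W 1 1 1 h = ⟨1, one_mem_groupCode⟩ := fun h =>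
    Subtype.ext (by funext t; simp [W, tripleWord])
  clear_value W i j k
  have hC := @isLatin_groupCode G _ n
  have hD := @isLatin_groupCode H _ n
  rw [← hφ] at l1 l2 l3
  have ck := fun x y z h x' y' h' =>
    image_plane hC hD φ hline hij.ne hik.ne hjk.ne hab hac hbc l1 l2 l3
      (p := W x y z h) (p' := W x' y' z h') (Wt x y z h) (Wt x' y' z h') (by rw [Wk, Wk])
  have cj := fun x y z h x' z' h' =>
    image_plane hC hD φ hline hik.ne hij.ne hjk.ne' hac hab hbc.symm l2 l1
      (by rw [codeLine_comm, l3, codeLine_comm])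
      (p := W x y z h) (p' := W x' y z' h') (fun t h1 h2 h3 => Wt x y z h t h1 h3 h2)
      (fun t h1 h2 h3 => Wt x' y z' h' t h1 h3 h2) (by rw [Wj, Wj])
  have ci := fun x y z h y' z' h' =>
    image_plane hC hD φ hline hjk.ne hij.ne' hik.ne' hbc hab.symm hac.symm l3
      (by rw [codeLine_comm, l1, codeLine_comm]) (by rw [codeLine_comm, l2, codeLine_comm])
      (p := W x y z h) (p' := W x y' z' h') (fun t h1 h2 h3 => Wt x y z h t h3 h1 h2)
      (fun t h1 h2 h3 => Wt x y' z' h' t h3 h1 h2) (by rw [Wi, Wi])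
  -- The choice of the two remaining letters is immaterial by `ci`, `cj` and `ck`.
  let f : G → H := fun x => (φ (W x x⁻¹ 1 (by simp))).1 a
  let g : G → H := fun y => (φ (W 1 y y⁻¹ (by simp))).1 b
  let h : G → H := fun z => (φ (W z⁻¹ 1 z (by simp))).1 c
  have f1 : f 1 = 1 := by simp [f, W1, hφ]
  have g1 : g 1 = 1 := by simp [g, W1, hφ]
  have h1 : h 1 = 1 := by simp [h, W1, hφ]
  have finj : Function.Injective f := by
    intro x y hxy
    have mem : ∀ x, φ (W x x⁻¹ 1 (by simp)) ∈ codeLine (φ ⟨1, one_mem_groupCode⟩) a b := by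
      intro x
      rw [← l1]
      refine ⟨_, fun t ht ht' => ?_, rfl⟩
      by_cases htk : t = k
      · rw [htk, Wk]; rfl
      · rw [Wt _ _ _ _ t ht ht' htk]; rfl
    have e := φ.injective (hD.eq_of_agreeOff (i := a) (j := b)
      (fun t ht ht' => (mem x t ht ht').trans (mem y t ht ht').symm) hxy)
    rw [← Wi x x⁻¹ 1 (by simp), e, Wi]
  have fbij : Function.Bijective f :=
    (Nat.bijective_iff_injective_and_card f).2 ⟨finj, hcard⟩
  have fa : ∀ x y z hh, (φ (W x y z hh)).1 a = f x := fun x y z hh => (ci x y z hh _ _ _).1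
  have gb : ∀ x y z hh, (φ (W x y z hh)).1 b = g y := fun x y z hh => (cj x y z hh _ _ _).1
  have hc : ∀ x y z hh, (φ (W x y z hh)).1 c = h z := fun x y z hh => (ck x y z hh _ _ _).1
  have supp : ∀ x y z hh t, t ≠ a → t ≠ b → t ≠ c → (φ (W x y z hh)).1 t = 1 := by
    intro x y z hh t t1 t2 t3
    rw [(ck x y z hh x y hh).2 t t1 t2 t3, hφ]; rfl
  rcases groupCode_triple (G := H) hab hac hbc with key | key
  · have hmul := map_mul_of_triple f1 g1 h1 fun x y z hh => by
      rw [← fa x y z hh, ← gb x y z hh, ← hc x y z hh]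
      exact key _ (supp x y z hh)
    exact ⟨MulEquiv.ofBijective (MonoidHom.mk' f hmul) fbij⟩
  -- In the reverse order `f` is an antihomomorphism; inverting its values gives a homomorphism.
  · have hmul := map_mul_of_triple (f := fun x => (f x)⁻¹) (g := fun x => (g x)⁻¹)
      (h := fun x => (h x)⁻¹) (by simp [f1]) (by simp [g1]) (by simp [h1]) fun x y z hh => by
      rw [← fa x y z hh, ← gb x y z hh, ← hc x y z hh, ← inv_eq_one, mul_inv_rev, mul_inv_rev,
        inv_inv, inv_inv, inv_inv, ← mul_assoc]
      exact key _ (supp x y z hh)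
    exact ⟨MulEquiv.ofBijective (MonoidHom.mk' (fun x => (f x)⁻¹) hmul)
      ((Equiv.inv H).bijective.comp fbij)⟩

end Recover

/-! ### A graph invariant that detects exponent two -/

section Scattered

/-- Two vertices that have distance at least three in the graph of common neighbours of `u` and
`v`. -/
def AreFar {V : Type*} (Γ : SimpleGraph V) (u v p q : V) : Prop :=
  p ≠ q ∧ ¬ Γ.Adj p q ∧ ∀ z, Γ.Adj u z → Γ.Adj v z → ¬ (Γ.Adj z p ∧ Γ.Adj z q)

/-- The graph has an edge with three common neighbours of its ends that are pairwise far. -/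
def HasScatteredTriple {V : Type*} (Γ : SimpleGraph V) : Prop :=
  ∃ u v p q r, Γ.Adj u v ∧ Γ.Adj u p ∧ Γ.Adj v p ∧ Γ.Adj u q ∧ Γ.Adj v q ∧ Γ.Adj u r ∧
    Γ.Adj v r ∧ AreFar Γ u v p q ∧ AreFar Γ u v p r ∧ AreFar Γ u v q r

theorem HasScatteredTriple.of_iso {V W : Type*} {Γ : SimpleGraph V} {Δ : SimpleGraph W}
    (h : HasScatteredTriple Γ) (φ : Γ ≃g Δ) : HasScatteredTriple Δ := by
  have far : ∀ {u v p q}, AreFar Γ u v p q → AreFar Δ (φ u) (φ v) (φ p) (φ q) := by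
    rintro u v p q ⟨h1, h2, h3⟩
    refine ⟨φ.injective.ne h1, fun h => h2 (φ.map_adj_iff.1 h), fun z => ?_⟩
    obtain ⟨z, rfl⟩ := φ.surjective z
    simpa only [φ.map_adj_iff] using h3 z
  obtain ⟨u, v, p, q, r, h1, h2, h3, h4, h5, h6, h7, h8, h9, h10⟩ := h
  refine ⟨φ u, φ v, φ p, φ q, φ r, ?_, ?_, ?_, ?_, ?_, ?_, ?_, far h8, far h9, far h10⟩ <;>
    rwa [φ.map_adj_iff]

theorem not_adj_of_three {ι G : Type*} {C : Set (ι → G)} {u v : C} {i j k : ι} (hij : i ≠ j)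
    (hik : i ≠ k) (hjk : j ≠ k) (hi : u.1 i ≠ v.1 i) (hj : u.1 j ≠ v.1 j) (hk : u.1 k ≠ v.1 k) :
    ¬ (codeGraph C).Adj u v := by
  rintro ⟨a, b, hab, ha, hb, h⟩
  rw [agreeOff_iff] at h
  have := h i
  have := h j
  have := h k
  grind

variable {G : Type*} [Group G] {n : ℕ}

/-- On three positions take `u = (1, 1, 1)`, `v = (x, x⁻¹, 1)`, `p = (x⁻¹, x, 1)`, `q = (x, 1, x⁻¹)`
and `r = (1, x⁻¹, x)`. The last three represent the three types of common neighbours in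
`codeGraph_triangle`, and a common neighbour of one type is not adjacent to the representatives of
the other two. -/
theorem hasScatteredTriple_groupCode (hn : 3 ≤ n) {x : G} (hx : x * x ≠ 1) :
    HasScatteredTriple (codeGraph (groupCode G n)) := by
  let i : Fin n := ⟨0, by omega⟩
  let j : Fin n := ⟨1, by omega⟩
  let k : Fin n := ⟨2, by omega⟩
  have hij : i < j := by simp [i, j, Fin.lt_def]
  have hjk : j < k := by simp [j, k, Fin.lt_def]
  clear_value i j k
  have hik := hij.trans hjk
  have hx1 : x ≠ 1 := by rintro rfl; simp at hx
  have hi1 : x⁻¹ ≠ 1 := inv_ne_one.2 hx1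
  have hxx : x ≠ x⁻¹ := fun e => hx (by nth_rewrite 2 [e]; simp)
  let W : ∀ x y z : G, x * y * z = 1 → groupCode G n := fun x y z h =>
    ⟨tripleWord i j k x y z, tripleWord_mem hij hjk h⟩
  have Wi : ∀ x y z h, (W x y z h).1 i = x := fun x y z h => by simp [W, tripleWord]
  have Wj : ∀ x y z h, (W x y z h).1 j = y := fun x y z h => by simp [W, tripleWord, hij.ne']
  have Wk : ∀ x y z h, (W x y z h).1 k = z := fun x y z h => by
    simp [W, tripleWord, hjk.ne', hik.ne']
  have Wt : ∀ x y z h t, t ≠ i → t ≠ j → t ≠ k → (W x y z h).1 t = 1 :=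
    fun x y z h t h1 h2 h3 => by simp [W, tripleWord, h1, h2, h3]
  clear_value W
  obtain ⟨u, hu⟩ : ∃ u, u = W 1 1 1 (by simp) := ⟨_, rfl⟩
  obtain ⟨v, hv⟩ : ∃ v, v = W x x⁻¹ 1 (by simp) := ⟨_, rfl⟩
  obtain ⟨p, hp⟩ : ∃ p, p = W x⁻¹ x 1 (by simp) := ⟨_, rfl⟩
  obtain ⟨q, hq⟩ : ∃ q, q = W x 1 x⁻¹ (by simp) := ⟨_, rfl⟩
  obtain ⟨r, hr⟩ : ∃ r, r = W 1 x⁻¹ x (by simp) := ⟨_, rfl⟩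
  have u1 : ∀ t, u.1 t = 1 := by
    intro t
    have := Wi 1 1 1 (by simp)
    have := Wj 1 1 1 (by simp)
    have := Wk 1 1 1 (by simp)
    have := Wt 1 1 1 (by simp) t
    grind
  have hC := @isLatin_groupCode G _ n
  have aij : ∀ x y h x' y' h', x ≠ x' → y ≠ y' →
      (codeGraph _).Adj (W x y 1 h) (W x' y' 1 h') := by
    intro x y h x' y' h' h1 h2
    refine ⟨i, j, hij.ne, by rwa [Wi, Wi], by rwa [Wj, Wj], fun t t1 t2 => ?_⟩
    by_cases tk : t = k
    · rw [tk, Wk, Wk]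
    · rw [Wt _ _ _ _ t t1 t2 tk, Wt _ _ _ _ t t1 t2 tk]
  have aik : ∀ x y z h x' z' h', x ≠ x' → z ≠ z' →
      (codeGraph _).Adj (W x y z h) (W x' y z' h') := by
    intro x y z h x' z' h' h1 h2
    refine ⟨i, k, hik.ne, by rwa [Wi, Wi], by rwa [Wk, Wk], fun t t1 t2 => ?_⟩
    by_cases tj : t = j
    · rw [tj, Wj, Wj]
    · rw [Wt _ _ _ _ t t1 tj t2, Wt _ _ _ _ t t1 tj t2]
  have ajk : ∀ x y z h y' z' h', y ≠ y' → z ≠ z' →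
      (codeGraph _).Adj (W x y z h) (W x y' z' h') := by
    intro x y z h y' z' h' h1 h2
    refine ⟨j, k, hjk.ne, by rwa [Wj, Wj], by rwa [Wk, Wk], fun t t1 t2 => ?_⟩
    by_cases ti : t = i
    · rw [ti, Wi, Wi]
    · rw [Wt _ _ _ _ t ti t1 t2, Wt _ _ _ _ t ti t1 t2]
  have n3 : ∀ x y z h x' y' z' h', x ≠ x' → y ≠ y' → z ≠ z' →
      W x y z h ≠ W x' y' z' h' ∧ ¬ (codeGraph _).Adj (W x y z h) (W x' y' z' h') := by
    intro x y z h x' y' z' h' h1 h2 h3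
    refine ⟨fun e => h1 (by rw [← Wi x y z h, e, Wi]), ?_⟩
    exact not_adj_of_three hij.ne hik.ne hjk.ne (by rwa [Wi, Wi]) (by rwa [Wj, Wj])
      (by rwa [Wk, Wk])
  have auv : (codeGraph _).Adj u v := by rw [hu, hv]; exact aij _ _ _ _ _ _ hx1.symm hi1.symm
  have aup : (codeGraph _).Adj u p := by rw [hu, hp]; exact aij _ _ _ _ _ _ hi1.symm hx1.symm
  have avp : (codeGraph _).Adj v p := by rw [hv, hp]; exact aij _ _ _ _ _ _ hxx hxx.symm
  have auq : (codeGraph _).Adj u q := by rw [hu, hq]; exact aik _ _ _ _ _ _ _ hx1.symm hi1.symm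
  have avq : (codeGraph _).Adj v q := by rw [hv, hq]; exact ajk _ _ _ _ _ _ _ hi1 hi1.symm
  have aur : (codeGraph _).Adj u r := by rw [hu, hr]; exact ajk _ _ _ _ _ _ _ hi1.symm hx1.symm
  have avr : (codeGraph _).Adj v r := by rw [hv, hr]; exact aik _ _ _ _ _ _ _ hx1 hx1.symm
  have npq : p ≠ q ∧ ¬ (codeGraph _).Adj p q := by
    rw [hp, hq]; exact n3 _ _ _ _ _ _ _ _ hxx.symm hx1 hi1.symm
  have npr : p ≠ r ∧ ¬ (codeGraph _).Adj p r := by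
    rw [hp, hr]; exact n3 _ _ _ _ _ _ _ _ hi1 hxx hx1.symm
  have nqr : q ≠ r ∧ ¬ (codeGraph _).Adj q r := by
    rw [hq, hr]; exact n3 _ _ _ _ _ _ _ _ hx1 hi1.symm hxx.symm
  have vi : v.1 i = x := by rw [hv, Wi]
  have vj : v.1 j = x⁻¹ := by rw [hv, Wj]
  have hvu : AgreeOff v.1 u.1 i j := by
    intro t t1 t2
    rw [u1]
    by_cases tk : t = k
    · rw [tk, hv, Wk]
    · rw [hv, Wt _ _ _ _ t t1 t2 tk]
  have pi : p.1 i = x⁻¹ := by rw [hp, Wi]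
  have pj : p.1 j = x := by rw [hp, Wj]
  have qi : q.1 i = x := by rw [hq, Wi]
  have qj : q.1 j = 1 := by rw [hq, Wj]
  have qk : q.1 k = x⁻¹ := by rw [hq, Wk]
  have ri : r.1 i = 1 := by rw [hr, Wi]
  have rj : r.1 j = x⁻¹ := by rw [hr, Wj]
  have rk : r.1 k = x := by rw [hr, Wk]
  have pt : ∀ t, t ≠ i → t ≠ j → p.1 t = 1 := by
    intro t t1 t2
    by_cases tk : t = k
    · rw [tk, hp, Wk]
    · rw [hp, Wt _ _ _ _ t t1 t2 tk]
  have qt : ∀ t, t ≠ i → t ≠ k → q.1 t = 1 := by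
    intro t t1 t2
    by_cases tj : t = j
    · rw [tj, qj]
    · rw [hq, Wt _ _ _ _ t t1 tj t2]
  have rt : ∀ t, t ≠ j → t ≠ k → r.1 t = 1 := by
    intro t t1 t2
    by_cases ti : t = i
    · rw [ti, ri]
    · rw [hr, Wt _ _ _ _ t ti t1 t2]
  have main : ∀ z, (codeGraph _).Adj u z → (codeGraph _).Adj v z →
      (¬ (codeGraph _).Adj z q ∧ ¬ (codeGraph _).Adj z r) ∨
      (¬ (codeGraph _).Adj z p ∧ ¬ (codeGraph _).Adj z r) ∨
      (¬ (codeGraph _).Adj z p ∧ ¬ (codeGraph _).Adj z q) := by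
    intro z huz hvz
    rcases codeGraph_triangle hij.ne (by rw [vi, u1]; exact hx1) (by rw [vj, u1]; exact hi1) hvu
      huz hvz with h | ⟨l, hli, hlj, e, hl, h⟩ | ⟨l, hli, hlj, e, hl, h⟩
    · left
      have hzv : AgreeOff z.1 v.1 i j := fun t t1 t2 => (h t t1 t2).trans (hvu t t1 t2).symm
      have zi : z.1 i ≠ 1 := fun e => huz.ne' (hC.eq_of_agreeOff h (by rw [e, u1]))
      have zj : z.1 j ≠ 1 := fun e => huz.ne' (hC.eq_of_agreeOff h.swap (by rw [e, u1]))
      have zi' : z.1 i ≠ x := fun e => hvz.ne' (hC.eq_of_agreeOff hzv (by rw [e, vi]))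
      have zj' : z.1 j ≠ x⁻¹ := fun e => hvz.ne' (hC.eq_of_agreeOff hzv.swap (by rw [e, vj]))
      have zk : z.1 k = 1 := by rw [h k hik.ne' hjk.ne', u1]
      exact ⟨not_adj_of_three hij.ne hik.ne hjk.ne (by rwa [qi]) (by rwa [qj])
          (by rw [qk, zk]; exact hi1.symm),
        not_adj_of_three hij.ne hik.ne hjk.ne (by rwa [ri]) (by rwa [rj])
          (by rw [rk, zk]; exact hx1.symm)⟩
    · right; left
      rw [vi] at e
      rw [u1] at hl
      have zj : z.1 j = 1 := by rw [h j hij.ne' hlj.symm, u1]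
      refine ⟨not_adj_of_three hij.ne hli.symm hlj.symm (by rw [e, pi]; exact hxx)
        (by rw [zj, pj]; exact hx1.symm) (by rwa [pt l hli hlj]), ?_⟩
      by_cases hlk : l = k
      · subst hlk
        have : z = q := hC.eq_of_agreeOff (i := i) (j := l)
          (fun t t1 t2 => by rw [h t t1 t2, u1, qt t t1 t2]) (by rw [e, qi])
        rw [this]; exact nqr.2
      · exact not_adj_of_three hij.ne hik.ne hjk.ne (by rw [e, ri]; exact hx1)
          (by rw [zj, rj]; exact hi1.symm)
          (by rw [h k hik.ne' (Ne.symm hlk), u1, rk]; exact hx1.symm)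
    · right; right
      rw [vj] at e
      rw [u1] at hl
      have zi : z.1 i = 1 := by rw [h i hij.ne hli.symm, u1]
      refine ⟨not_adj_of_three hij.ne hli.symm hlj.symm (by rw [zi, pi]; exact hi1.symm)
        (by rw [e, pj]; exact hxx.symm) (by rwa [pt l hli hlj]), ?_⟩
      by_cases hlk : l = k
      · subst hlk
        have : z = r := hC.eq_of_agreeOff (i := j) (j := l)
          (fun t t1 t2 => by rw [h t t1 t2, u1, rt t t1 t2]) (by rw [e, rj])
        rw [this]; exact fun h => nqr.2 h.symm
      · exact not_adj_of_three hij.ne hik.ne hjk.ne (by rw [zi, qi]; exact hx1.symm)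
          (by rw [e, qj]; exact hi1)
          (by rw [h k hjk.ne' (Ne.symm hlk), u1, qk]; exact hi1.symm)
  refine ⟨u, v, p, q, r, auv, aup, avp, auq, avq, aur, avr, ⟨npq.1, npq.2, ?_⟩,
    ⟨npr.1, npr.2, ?_⟩, ⟨nqr.1, nqr.2, ?_⟩⟩ <;>
  · intro z hz hz'
    have := main z hz hz'
    tauto

theorem mul_comm_of_mul_self (h2 : ∀ x : G, x * x = 1) (x y : G) : x * y = y * x := by
  have inv : ∀ x : G, x⁻¹ = x := fun x => inv_eq_of_mul_eq_one_left (h2 x)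
  rw [← inv (x * y), mul_inv_rev, inv, inv]

theorem mul_mem_groupCode (hc : ∀ x y : G, x * y = y * x) {d d' : Fin n → G}
    (hd : d ∈ groupCode G n) (hd' : d' ∈ groupCode G n) : d * d' ∈ groupCode G n := by
  have key : ∀ k, partProd (d * d') k = partProd d k * partProd d' k := by
    intro k
    induction k with
    | zero => simp [partProd]
    | succ k ih =>
      simp only [partProd, ih]
      split_ifs with h
      · rw [Pi.mul_apply, mul_assoc, mul_assoc, ← mul_assoc (partProd d' k),
          hc (partProd d' k), mul_assoc]
      · simp
  change partProd _ n = 1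
  rw [key, show partProd d n = 1 from hd, show partProd d' n = 1 from hd', one_mul]

/-- The code is closed under letterwise products, so `p * u * v` is a codeword. Squares being
trivial, it agrees with `q` off `l`, hence equals `q`; and it agrees with `p` off `i` and `j`. -/
theorem agreeOff_of_mul_self (h2 : ∀ x : G, x * x = 1) {u v p q : groupCode G n} {i j l : Fin n}
    (hij : i ≠ j) (hli : l ≠ i) (hlj : l ≠ j) (hvu : AgreeOff v.1 u.1 i j)
    (hpi : p.1 i = v.1 i) (hp : AgreeOff p.1 u.1 i l)
    (hqj : q.1 j = v.1 j) (hq : AgreeOff q.1 u.1 j l) : AgreeOff p.1 q.1 i j := by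
  have hc := mul_comm_of_mul_self h2
  let w : groupCode G n := ⟨p.1 * u.1 * v.1,
    mul_mem_groupCode hc (mul_mem_groupCode hc p.2 u.2) v.2⟩
  have hw : ∀ t, w.1 t = p.1 t * u.1 t * v.1 t := fun t => rfl
  clear_value w
  have hwp : ∀ t, t ≠ i → t ≠ j → w.1 t = p.1 t := fun t t1 t2 => by
    rw [hw, hvu t t1 t2, mul_assoc, h2, mul_one]
  have : w = q := isLatin_groupCode.eq_of_agree l fun t tl => by
    by_cases ti : t = i
    · subst ti
      rw [hw, hpi, hc (v.1 t), mul_assoc, h2, mul_one, hq t hij tl]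
    by_cases tj : t = j
    · subst tj
      rw [hw, hqj, hp t hij.symm tl, h2, one_mul]
    rw [hwp t ti tj, hp t ti tl, hq t tj tl]
  intro t t1 t2
  rw [← this, hwp t t1 t2]

theorem not_areFar_of_mul_self (h2 : ∀ x : G, x * x = 1) {u v p q : groupCode G n} {i j : Fin n}
    (hij : i ≠ j) (hi : v.1 i ≠ u.1 i) (hj : v.1 j ≠ u.1 j) (hvu : AgreeOff v.1 u.1 i j)
    {l l' : Fin n} (hli : l ≠ i) (hlj : l ≠ j) (hpi : p.1 i = v.1 i) (hpl : p.1 l ≠ u.1 l)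
    (hp : AgreeOff p.1 u.1 i l) (hli' : l' ≠ i) (hlj' : l' ≠ j)
    (hq : (q.1 i = v.1 i ∧ AgreeOff q.1 u.1 i l') ∨ (q.1 j = v.1 j ∧ AgreeOff q.1 u.1 j l')) :
    ¬ AreFar (codeGraph (groupCode G n)) u v p q := by
  have hC := @isLatin_groupCode G _ n
  rintro ⟨hne, hnadj, hz⟩
  rcases hq with ⟨hqi, hq⟩ | ⟨hqj, hq⟩
  · by_cases hll : l = l'
    · subst hll
      exact hne (hC.eq_of_agreeOff (fun t t1 t2 => (hp t t1 t2).trans (hq t t1 t2).symm)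
        (hpi.trans hqi.symm))
    · refine hnadj (hC.adj_of_agreeOff hll (fun t t1 t2 => ?_) hne)
      by_cases ti : t = i
      · rw [ti, hpi, hqi]
      · exact (hp t ti t1).trans (hq t ti t2).symm
  · by_cases hll : l = l'
    · subst hll
      exact hnadj (hC.adj_of_agreeOff hij
        (agreeOff_of_mul_self h2 hij hli hlj hvu hpi hp hqj hq) hne)
    -- The common neighbour of the type of `p` in the direction `l'` of `q` is adjacent to both.
    · obtain ⟨z, hzi, hzu⟩ := hC.exists_agreeOff u hli'.symm (v.1 i)
      refine hz z ?_ ?_ ⟨?_, ?_⟩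
      · exact (hC.adj_of_agreeOff hli'.symm hzu fun e => hi (by rw [← hzi, e])).symm
      · refine (hC.adj_of_agreeOff hlj'.symm (fun t t1 t2 => ?_) fun e => hj ?_).symm
        · by_cases ti : t = i
          · rw [ti, hzi]
          · exact (hzu t ti t2).trans (hvu t ti t1).symm
        · rw [← e, hzu j hij.symm hlj'.symm]
      · refine hC.adj_of_agreeOff hll (fun t t1 t2 => ?_) fun e => hpl ?_
        · by_cases ti : t = i
          · rw [ti, hzi, hpi]
          · exact (hzu t ti t2).trans (hp t ti t1).symm
        · rw [← e, hzu l hli hll]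
      · refine hC.adj_of_agreeOff hij
          (agreeOff_of_mul_self h2 hij hli' hlj' hvu hzi hzu hqj hq) fun e => hi ?_
        rw [← hzi, e, hq i hij hli'.symm]

/-- Two common neighbours on the line through `u` and `v` are equal or adjacent, and two off it are
never far. So of two far ones exactly one lies on the line, which is impossible for all pairs out of
three. -/
theorem not_hasScatteredTriple_groupCode (h2 : ∀ x : G, x * x = 1) :
    ¬ HasScatteredTriple (codeGraph (groupCode G n)) := by
  have hC := @isLatin_groupCode G _ n
  rintro ⟨u, v, p, q, r, huv, hup, hvp, huq, hvq, hur, hvr, fpq, fpr, fqr⟩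
  obtain ⟨i, j, hij, hi, hj, hvu⟩ := huv.symm
  have key : ∀ p q, (codeGraph _).Adj u p → (codeGraph _).Adj v p → (codeGraph _).Adj u q →
      (codeGraph _).Adj v q → AreFar (codeGraph (groupCode G n)) u v p q →
      (AgreeOff p.1 u.1 i j ↔ ¬ AgreeOff q.1 u.1 i j) := by
    intro p q hup hvp huq hvq hfar
    constructor
    · intro hp hq
      exact hfar.2.1 (hC.adj_of_agreeOff hij
        (fun t t1 t2 => (hp t t1 t2).trans (hq t t1 t2).symm) hfar.1)
    · intro hq
      by_contra hp
      have tp := (codeGraph_triangle hij hi hj hvu hup hvp).resolve_left hp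
      have tq := (codeGraph_triangle hij hi hj hvu huq hvq).resolve_left hq
      rcases tp with ⟨l, hli, hlj, e, hl, h⟩ | ⟨l, hli, hlj, e, hl, h⟩
      · rcases tq with ⟨l', hli', hlj', e', hl', h'⟩ | ⟨l', hli', hlj', e', hl', h'⟩
        · exact not_areFar_of_mul_self h2 hij hi hj hvu hli hlj e hl h hli' hlj'
            (Or.inl ⟨e', h'⟩) hfar
        · exact not_areFar_of_mul_self h2 hij hi hj hvu hli hlj e hl h hli' hlj'
            (Or.inr ⟨e', h'⟩) hfar
      · rcases tq with ⟨l', hli', hlj', e', hl', h'⟩ | ⟨l', hli', hlj', e', hl', h'⟩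
        · exact not_areFar_of_mul_self h2 hij.symm hj hi hvu.swap hlj hli e hl h hlj' hli'
            (Or.inr ⟨e', h'⟩) hfar
        · exact not_areFar_of_mul_self h2 hij.symm hj hi hvu.swap hlj hli e hl h hlj' hli'
            (Or.inl ⟨e', h'⟩) hfar
  have k1 := key p q hup hvp huq hvq fpq
  have k2 := key p r hup hvp hur hvr fpr
  have k3 := key q r huq hvq hur hvr fqr
  tauto

end Scattered

/-! ### Functoriality, small and elementary abelian groups, and conclusion -/

section Main

theorem intervalCayGraph_adj_map {G H : Type*} [Group G] [Group H] {m : ℕ} (e : G ≃* H)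
    {g h : Fin m → G} (hgh : (intervalCayGraph m G).Adj g h) :
    (intervalCayGraph m H).Adj (e ∘ g) (e ∘ h) := by
  obtain ⟨s, ⟨x, k, l, hx, hk, hkl, hl, rfl⟩, rfl⟩ := hgh
  refine ⟨intervalElem m (e x) k l, ⟨_, _, _, by simpa using hx, hk, hkl, hl, rfl⟩, ?_⟩
  funext i
  simp only [Function.comp_apply, Pi.mul_apply, map_mul, intervalElem]
  split_ifs <;> simp

/-- A group isomorphism induces a graph isomorphism. -/
def intervalCayGraphCongr {G H : Type*} [Group G] [Group H] (m : ℕ) (e : G ≃* H) :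
    intervalCayGraph m G ≃g intervalCayGraph m H where
  toEquiv := Equiv.piCongrRight fun _ => e.toEquiv
  map_rel_iff' := by
    intro g h
    refine ⟨fun hgh => ?_, fun hgh => intervalCayGraph_adj_map e hgh⟩
    have := intervalCayGraph_adj_map e.symm hgh
    convert this using 1 <;> · funext i; simp

theorem natCard_eq_of_iso {G H : Type*} [Group G] [Finite G] [Group H] [Finite H] {m : ℕ}
    (hm : m ≠ 0) (ψ : intervalCayGraph m G ≃g intervalCayGraph m H) :
    Nat.card G = Nat.card H := by
  have h := Nat.card_congr ψ.toEquiv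
  rw [Nat.card_fun, Nat.card_fun, Nat.card_fin] at h
  exact Nat.pow_left_injective hm h

/-- Both groups are vector spaces over `ZMod 2`, and the order determines the dimension. -/
theorem nonempty_mulEquiv_of_mul_self {G H : Type*} [Group G] [Finite G] [Group H] [Finite H]
    (hG : ∀ x : G, x * x = 1) (hH : ∀ x : H, x * x = 1) (hcard : Nat.card G = Nat.card H) :
    Nonempty (G ≃* H) := by
  let _ : CommGroup G := { ‹Group G› with mul_comm := mul_comm_of_mul_self hG }
  let _ : CommGroup H := { ‹Group H› with mul_comm := mul_comm_of_mul_self hH }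
  let _ : Module (ZMod 2) (Additive G) := AddCommGroup.zmodModule fun x => by
    rw [two_nsmul]; exact hG x.toMul
  let _ : Module (ZMod 2) (Additive H) := AddCommGroup.zmodModule fun x => by
    rw [two_nsmul]; exact hH x.toMul
  have h1 := Module.natCard_eq_pow_finrank (K := ZMod 2) (V := Additive G)
  have h2 := Module.natCard_eq_pow_finrank (K := ZMod 2) (V := Additive H)
  have h3 : Nat.card (Additive G) = Nat.card (Additive H) := hcard
  rw [h1, h2, Nat.card_zmod] at h3
  obtain ⟨e⟩ := FiniteDimensional.nonempty_linearEquiv_of_finrank_eq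
    (Nat.pow_right_injective le_rfl h3)
  exact ⟨AddEquiv.toMultiplicative e.toAddEquiv⟩

/-- The order of `x` is at least three and divides a number at most four, so `x` generates. -/
theorem isCyclic_of_card_le_four {G : Type*} [Group G] [Finite G] (h4 : Nat.card G ≤ 4)
    (hx : ∃ x : G, x * x ≠ 1) : IsCyclic G := by
  obtain ⟨x, hx⟩ := hx
  apply isCyclic_of_orderOf_eq_card x
  have h0 := orderOf_pos x
  have h1 : orderOf x ≠ 1 := fun h => hx (by rw [orderOf_eq_one_iff.1 h, one_mul])
  have h2 : orderOf x ≠ 2 := fun h => hx (by rw [← sq, ← h, pow_orderOf_eq_one])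
  obtain ⟨c, hc⟩ := orderOf_dvd_natCard x
  have hpos : 0 < Nat.card G := Nat.card_pos
  have hc1 : c = 1 := by
    have : c ≠ 0 := by rintro rfl; omega
    have : c < 2 := by nlinarith [show 3 ≤ orderOf x by omega]
    omega
  rw [hc, hc1, mul_one]

end Main

theorem theorem6p12 {G : Type*} {H : Type*} [Group G] [Finite G] [Group H] [Finite H]
    (m : ℕ) (hm : 1 < m) :
    Nonempty (intervalCayGraph m G ≃g intervalCayGraph m H) ↔ Nonempty (G ≃* H) := by
  refine ⟨?_, fun ⟨e⟩ => ⟨intervalCayGraphCongr m e⟩⟩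
  rintro ⟨ψ⟩
  have hcard := natCard_eq_of_iso (by omega) ψ
  obtain ⟨φ, hφ⟩ := exists_codeGraph_iso ψ
  by_cases hG : ∃ x : G, x * x ≠ 1
  · have hH : ∃ x : H, x * x ≠ 1 := by
      by_contra! hH
      obtain ⟨x, hx⟩ := hG
      exact not_hasScatteredTriple_groupCode hH
        ((hasScatteredTriple_groupCode (by omega) hx).of_iso φ)
    -- Five is the clique size from which maximal cliques are known to be lines or stars.
    by_cases h5 : 5 ≤ Nat.card G
    · exact nonempty_mulEquiv_of_lines φ hφ
        (fun u _ _ hij => exists_image_codeLine isLatin_groupCode isLatin_groupCode φ hcard h5 rfl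
          u hij) hcard hG (by omega)
    · have := isCyclic_of_card_le_four (by omega) hG
      have := isCyclic_of_card_le_four (by omega) hH
      exact ⟨mulEquivOfCyclicCardEq hcard⟩
  · by_cases hH : ∃ x : H, x * x ≠ 1
    · obtain ⟨x, hx⟩ := hH
      push Not at hG
      exact absurd ((hasScatteredTriple_groupCode (by omega) hx).of_iso φ.symm)
        (not_hasScatteredTriple_groupCode hG)
    · push Not at hG hH
      exact nonempty_mulEquiv_of_mul_self hG hH hcard
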